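/- A \emph{modular decomposition tree} of a finite graph $G=(V,E)$ is a rooted tree $T$ with a one-to-one correspondence between its leaves and $V$, in which every internal node is labelled as a union node, a join node or a prime node, and every prime node $p$ carries a graph $H_p$ whose vertices correspond one-to-one to the children of $p$, such that $T$ defines $G$ in the following way. A leaf stands for a one-vertex graph. A union node stands for the disjoint union of the graphs represented by its children. A join node stands for the graph obtained from that disjoint union by adding all edges between vertices of different children. A prime node $p$ stands for the graph obtained from that disjoint union by adding all edges between the vertices of two children whenever the corresponding vertices of $H_p$ are adjacent. The graph $G$ is represented by the root. For a natural number $k$, the graph $G$ is \emph{$k$-modular} if it has a modular decomposition tree such that $H_p$ has at most $k$ vertices for every prime node $p$. A \emph{triangle packing} in $G$ is a collection of pairwise vertex-disjoint triangles of $G$; it is \emph{maximum} if no triangle packing in $G$ contains more triangles. \textbf{Theorem.} For every natural number $k$ there exist an algorithm (a program for a unit-cost random access machine with addition, truncated subtraction and indirect addressing) and a polynomial $p$ such that for every $k$-modular graph $G$ with $n$ vertices, given by its adjacency matrix, the algorithm halts after at most $p(n)$ steps and outputs a maximum triangle packing in $G$. -/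

import Mathlib

/-! ### A random access machine with a step count

The machine has registers and arrays that hold natural numbers. A program is a fixed finite text,
so it mentions finitely many registers and finitely many (unbounded) arrays. Constants, addition,
truncated subtraction, indirect reads and writes of arrays, and tests against zero cost one step
each; there is no multiplication. This is the unit-cost RAM of the textbooks: a value that is
produced in `t` steps has at most `t + O(log (largest input number))` bits (for a fixed program), so polynomial time on
it is polynomial time on Turing machines. -/

namespace RAM

/-- A memory: `reg r` is the content of register `r`; `arr a i` is entry `i` of array `a`. -/
structure State where
  reg : ℕ → ℕ
  arr : ℕ → ℕ → ℕ

/-- `s.setReg r v` is `s` with the content of register `r` replaced by `v`. -/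
def State.setReg (s : State) (r v : ℕ) : State :=
  { s with reg := Function.update s.reg r v }

/-- `s.setArr a i v` is `s` with entry `i` of array `a` replaced by `v`. -/
def State.setArr (s : State) (a i v : ℕ) : State :=
  { s with arr := Function.update s.arr a (Function.update (s.arr a) i v) }

/-- Programs. -/
inductive Prog : Type
  /-- `reg x := c` -/
  | const (x c : ℕ)
  /-- `reg x := reg y + reg z` -/
  | add (x y z : ℕ)
  /-- `reg x := reg y - reg z`, truncated at `0` -/
  | sub (x y z : ℕ)
  /-- `reg x := arr a (reg i)` -/
  | load (x a i : ℕ)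
  /-- `arr a (reg i) := reg x` -/
  | store (a i x : ℕ)
  /-- first `p`, then `q` -/
  | seq (p q : Prog)
  /-- if `reg x ≠ 0` then `p` else `q` -/
  | cond (x : ℕ) (p q : Prog)
  /-- while `reg x ≠ 0` do `p` -/
  | loop (x : ℕ) (p : Prog)

/-- `Exec p s t s'`: the program `p`, started in the memory `s`, halts after exactly `t` steps with
the memory `s'`. -/
inductive Exec : Prog → State → ℕ → State → Prop
  | const (x c : ℕ) (s : State) : Exec (.const x c) s 1 (s.setReg x c)
  | add (x y z : ℕ) (s : State) : Exec (.add x y z) s 1 (s.setReg x (s.reg y + s.reg z))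
  | sub (x y z : ℕ) (s : State) : Exec (.sub x y z) s 1 (s.setReg x (s.reg y - s.reg z))
  | load (x a i : ℕ) (s : State) : Exec (.load x a i) s 1 (s.setReg x (s.arr a (s.reg i)))
  | store (a i x : ℕ) (s : State) : Exec (.store a i x) s 1 (s.setArr a (s.reg i) (s.reg x))
  | seq {p q : Prog} {s s₁ s₂ : State} {t₁ t₂ : ℕ} (hp : Exec p s t₁ s₁) (hq : Exec q s₁ t₂ s₂) :
      Exec (.seq p q) s (t₁ + t₂) s₂
  | condTrue {x : ℕ} {p q : Prog} {s s₁ : State} {t : ℕ} (hx : s.reg x ≠ 0) (hp : Exec p s t s₁) :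
      Exec (.cond x p q) s (t + 1) s₁
  | condFalse {x : ℕ} {p q : Prog} {s s₁ : State} {t : ℕ} (hx : s.reg x = 0) (hq : Exec q s t s₁) :
      Exec (.cond x p q) s (t + 1) s₁
  | loopDone {x : ℕ} {p : Prog} {s : State} (hx : s.reg x = 0) : Exec (.loop x p) s 1 s
  | loopStep {x : ℕ} {p : Prog} {s s₁ s₂ : State} {t₁ t₂ : ℕ} (hx : s.reg x ≠ 0)
      (hp : Exec p s t₁ s₁) (hl : Exec (.loop x p) s₁ t₂ s₂) :
      Exec (.loop x p) s (t₁ + t₂ + 1) s₂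

/-- The machine is deterministic: the running time and the final memory are determined by the
program and the initial memory. -/
theorem Exec.deterministic {p : Prog} {s s₁ s₂ : State} {t₁ t₂ : ℕ} (h₁ : Exec p s t₁ s₁)
    (h₂ : Exec p s t₂ s₂) : t₁ = t₂ ∧ s₁ = s₂ := by
  induction h₁ generalizing t₂ s₂ with
  | const | add | sub | load | store => cases h₂; exact ⟨rfl, rfl⟩
  | seq _ _ ihp ihq =>
    cases h₂ with
    | seq hp hq =>
      obtain ⟨rfl, rfl⟩ := ihp hp
      obtain ⟨rfl, rfl⟩ := ihq hq
      exact ⟨rfl, rfl⟩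
  | condTrue hx _ ih =>
    cases h₂ with
    | condTrue _ hp => obtain ⟨rfl, rfl⟩ := ih hp; exact ⟨rfl, rfl⟩
    | condFalse hx' _ => exact absurd hx' hx
  | condFalse hx _ ih =>
    cases h₂ with
    | condTrue hx' _ => exact absurd hx hx'
    | condFalse _ hp => obtain ⟨rfl, rfl⟩ := ih hp; exact ⟨rfl, rfl⟩
  | loopDone hx =>
    cases h₂ with
    | loopDone => exact ⟨rfl, rfl⟩
    | loopStep hx' => exact absurd hx hx'
  | loopStep hx _ _ ihp ihl =>
    cases h₂ with
    | loopDone hx' => exact absurd hx' hx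
    | loopStep _ hp hl =>
      obtain ⟨rfl, rfl⟩ := ihp hp
      obtain ⟨rfl, rfl⟩ := ihl hl
      exact ⟨rfl, rfl⟩

open Classical in
/-- The initial memory on the input graph `G` with vertices `0, …, n - 1`: register `0` holds `n`,
array `0` holds the adjacency matrix of `G` row by row, and everything else is `0`. -/
noncomputable def graphInput {n : ℕ} (G : SimpleGraph (Fin n)) : State where
  reg r := if r = 0 then n else 0
  arr a m := if a = 0 ∧ ∃ i j : Fin n, m = i.val * n + j.val ∧ G.Adj i j then 1 else 0

/-- `s.OutputsTriples P`: register `0` holds the number `q` of members of `P`, and the members of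
`P` are the sets `{arr 1 (3 t), arr 1 (3 t + 1), arr 1 (3 t + 2)}` with `t < q`. -/
def State.OutputsTriples (s : State) {n : ℕ} (P : Finset (Finset (Fin n))) : Prop :=
  P.card = s.reg 0 ∧
    P.image (fun T => T.image Fin.val) =
      (Finset.range (s.reg 0)).image
        (fun t => {s.arr 1 (3 * t), s.arr 1 (3 * t + 1), s.arr 1 (3 * t + 2)})

end RAM

/-! ### Modular decomposition trees -/

/-- Rooted trees whose leaves carry elements of `V` and whose internal nodes, with `m` children
each, are union nodes, join nodes, or prime nodes labelled with a graph `H` that has one vertex for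
each child. -/
inductive ModularTree (V : Type*) : Type _
  | leaf (v : V)
  | union (m : ℕ) (child : Fin m → ModularTree V)
  | join (m : ℕ) (child : Fin m → ModularTree V)
  | prime (m : ℕ) (H : SimpleGraph (Fin m)) (child : Fin m → ModularTree V)

namespace ModularTree

variable {V : Type*}

/-- The list of the elements at the leaves, from left to right. -/
def leaves : ModularTree V → List V
  | leaf v => [v]
  | union _ child => (List.ofFn fun i => (child i).leaves).flatten
  | join _ child => (List.ofFn fun i => (child i).leaves).flatten
  | prime _ _ child => (List.ofFn fun i => (child i).leaves).flatten

/-- Adjacency in the graph that the tree defines. A union node adds no edges to the graphs of its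
children, a join node adds all edges between different children, and a prime node adds all edges
between two children whose vertices of `H` are adjacent. -/
def Adj : ModularTree V → V → V → Prop
  | leaf _, _, _ => False
  | union _ child, u, v => ∃ i, (child i).Adj u v
  | join _ child, u, v =>
      (∃ i, (child i).Adj u v) ∨
        ∃ i j, i ≠ j ∧ u ∈ (child i).leaves ∧ v ∈ (child j).leaves
  | prime _ H child, u, v =>
      (∃ i, (child i).Adj u v) ∨
        ∃ i j, H.Adj i j ∧ u ∈ (child i).leaves ∧ v ∈ (child j).leaves

/-- The graph of every prime node has at most `k` vertices. -/
def PrimeNodesAtMost (k : ℕ) : ModularTree V → Prop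
  | leaf _ => True
  | union _ child => ∀ i, (child i).PrimeNodesAtMost k
  | join _ child => ∀ i, (child i).PrimeNodesAtMost k
  | prime m _ child => m ≤ k ∧ ∀ i, (child i).PrimeNodesAtMost k

/-- `T` is a modular decomposition tree of `G`: the leaves of `T` are in one-to-one correspondence
with the vertices of `G`, and `T` defines the graph `G`. -/
structure IsDecompositionOf (T : ModularTree V) (G : SimpleGraph V) : Prop where
  nodup_leaves : T.leaves.Nodup
  mem_leaves : ∀ v, v ∈ T.leaves
  adj_iff : ∀ u v, G.Adj u v ↔ T.Adj u v

end ModularTree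

namespace SimpleGraph

variable {V : Type*}

/-- `G` is `k`-modular: it has a modular decomposition tree in which the graph of every prime node
has at most `k` vertices. -/
def IsModular (k : ℕ) (G : SimpleGraph V) : Prop :=
  ∃ T : ModularTree V, T.IsDecompositionOf G ∧ T.PrimeNodesAtMost k

/-- A triangle packing of `G`: a collection of pairwise disjoint triangles of `G`. -/
structure IsTrianglePacking (G : SimpleGraph V) (P : Finset (Finset V)) : Prop where
  isTriangle : ∀ T ∈ P, G.IsNClique 3 T
  disjoint : ∀ S ∈ P, ∀ T ∈ P, S ≠ T → Disjoint S T

/-- A triangle packing of `G` of maximum cardinality. -/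
structure IsMaximumTrianglePacking (G : SimpleGraph V) (P : Finset (Finset V)) : Prop
    extends G.IsTrianglePacking P where
  card_le : ∀ Q : Finset (Finset V), G.IsTrianglePacking Q → Q.card ≤ P.card

end SimpleGraph

/-!
A triangle packing can be found by self-reduction once the packing numbers of induced subgraphs can
be computed: a triangle `T` in the set `S` of remaining vertices is moved to the output whenever the
packing number of `S \ T` is only one less than that of `S`, and every member of a maximum packing
of `S` is such a triangle (`SimpleGraph.exists_triangle_packNum`).

The packing number of an induced subgraph is computed without constructing a decomposition tree. The
vertex set is partitioned into blocks, at first singletons, such that adjacency of vertices in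
different blocks is adjacency of the representatives of the blocks. The representatives induce a
subgraph of `G`, and as long as there are at least two of them, this subgraph has a module with at
least `2` and at most `k + 2` elements, namely one that belongs to a lowest node of the tree with
two representatives below it (`ModularTree.exists_module`). Such a module is found by trying all
tuples of `k + 2` vertices, and its blocks are merged into one.

For each block the algorithm keeps the profile (`SimpleGraph.Prof`): the triples `(c₁, c₂, c₃)` such
that the block contains disjoint cliques, `cⱼ` of which have size `j`. A family of disjoint cliques
of size at most three in a union of blocks is the same as a family of traces in each block, fitted
together along pairwise adjacent blocks (`SimpleGraph.packable_biUnion`). Whether the traces exist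
depends only on how many of each size are needed. So the profile of the union is obtained from the
profiles of the blocks by guessing, for each of the boundedly many types of cliques, the number of
cliques of this type (`SimpleGraph.prof_biUnion`). When one block is left, its profile contains the
packing number.

To run this on the random access machine, programs are written in a language in which the only
control structures are conditionals and loops over all `x < N`, with `N = n + 1`, and in which
expressions contain bounded sums and hence bounded quantifiers. Each command of this language
compiles to a program that runs in time polynomial in `N` (`Cmd.compile`). The correctness of nested
loops is reduced to properties of one round: such loops fill an array (`Cmd.filled_loops_put`) or
decrease a measure unless no round changes anything (`Cmd.run_loops_measure`).
-/

open RAM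

/-! ### A language of bounded loops -/

/-- Variables of the bounded language. They are bound by bounded sums and bounded loops only. The
three families serve for loop counters, for the members of a tuple of vertices, and for the
multiplicities of clique types. -/
inductive Name : Type
  | aux (i : ℕ)
  | slot (i : ℕ)
  | mult (i : ℕ)
  deriving DecidableEq

/-- The register that holds a variable. Registers divisible by `4` remain for other purposes. -/
def Name.code : Name → ℕ
  | aux i => 4 * i + 1
  | slot i => 4 * i + 2
  | mult i => 4 * i + 3

theorem Name.code_injective : Function.Injective Name.code := by
  intro x y h
  cases x <;> cases y <;> simp only [Name.code] at h <;> first | omega | (congr 1; omega)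

theorem Name.code_mod (x : Name) : x.code % 4 ≠ 0 := by
  cases x <;> simp only [Name.code] <;> omega

/-- Values of the variables. -/
abbrev Env := Name → ℕ

/-- Contents of the arrays. -/
abbrev Store := ℕ → ℕ → ℕ

/-- Expressions: terms over the variables and the arrays, closed under the sum `∑ x < N`, where the
bound `N` is a global parameter. -/
inductive Exp : Type
  | var (x : Name)
  | const (c : ℕ)
  | add (e f : Exp)
  | sub (e f : Exp)
  | get (a : ℕ) (i : Exp)
  | sum (x : Name) (e : Exp)

/-- The value of an expression. -/
def Exp.eval (N : ℕ) (A : Store) : Exp → Env → ℕ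
  | var x, η => η x
  | const c, _ => c
  | add e f, η => e.eval N A η + f.eval N A η
  | sub e f, η => e.eval N A η - f.eval N A η
  | get a i, η => A a (i.eval N A η)
  | sum x e, η => ∑ i ∈ Finset.range N, e.eval N A (Function.update η x i)

/-- Commands: array assignments, closed under sequencing, conditionals, and the loop over all
`x < N`. Only arrays are mutable. -/
inductive Cmd : Type
  | skip
  | put (a : ℕ) (i e : Exp)
  | seq (c c' : Cmd)
  | ifnz (e : Exp) (c : Cmd)
  | loop (x : Name) (c : Cmd)

/-- The arrays after a command. -/
def Cmd.run (N : ℕ) : Cmd → Env → Store → Store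
  | skip, _, A => A
  | put a i e, η, A =>
      Function.update A a (Function.update (A a) (i.eval N A η) (e.eval N A η))
  | seq c c', η, A => c'.run N η (c.run N η A)
  | ifnz e c, η, A => if e.eval N A η ≠ 0 then c.run N η A else A
  | loop x c, η, A =>
      (List.range N).foldl (fun A i => c.run N (Function.update η x i) A) A

/-! ### Compilation to the random access machine -/

/-- The values of the variables in a memory of the machine. -/
def RAM.State.env (s : State) : Env := fun x => s.reg x.code

/-- `s'` differs from `s` at most in the arrays and in the temporary registers `4 i` with
`i ≥ d`. -/
def RAM.State.AgreesBelow (d : ℕ) (s s' : State) : Prop :=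
  ∀ r, r % 4 ≠ 0 ∨ r < 4 * d → s'.reg r = s.reg r

theorem RAM.State.AgreesBelow.env_eq {d : ℕ} {s s' : State} (h : s.AgreesBelow d s') :
    s'.env = s.env :=
  funext fun x => h _ (Or.inl x.code_mod)

/-- A loop that counts a register down to zero. -/
theorem exec_countdown {body : Prog} {r T : ℕ} (I : ℕ → State → Prop)
    (hbody : ∀ j s, I (j + 1) s → s.reg r = j + 1 →
      ∃ t s', Exec body s t s' ∧ t ≤ T ∧ I j s' ∧ s'.reg r = j) :
    ∀ j s, I j s → s.reg r = j →
      ∃ t s', Exec (.loop r body) s t s' ∧ t ≤ j * (T + 1) + 1 ∧ I 0 s' := by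
  intro j
  induction j with
  | zero => exact fun s hI hr => ⟨1, s, .loopDone hr, by omega, hI⟩
  | succ j ih =>
    intro s hI hr
    obtain ⟨t, s', he, ht, hI', hr'⟩ := hbody j s hI hr
    obtain ⟨u, s'', he', hu, hI''⟩ := ih s' hI' hr'
    refine ⟨_, s'', .loopStep (by omega) he he', ?_, hI''⟩
    rw [Nat.succ_mul]
    omega

@[simp]
theorem RAM.State.env_setReg (s : State) (x : Name) (v : ℕ) :
    (s.setReg x.code v).env = Function.update s.env x v := by
  funext y
  simp only [RAM.State.env, State.setReg, Function.update_apply, Name.code_injective.eq_iff]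

/-- The program `P` evaluates `v` into temporary register `4 d`, in time `p` of the bound `N`, which
is kept in register `0`. -/
def Evaluates (P : Prog) (p : Polynomial ℕ) (d : ℕ) (v : ℕ → Store → Env → ℕ) : Prop :=
  ∀ s : State, ∃ t s', Exec P s t s' ∧ t ≤ p.eval (s.reg 0) ∧
    s'.reg (4 * d) = v (s.reg 0) s.arr s.env ∧ s'.arr = s.arr ∧ s.AgreesBelow d s'

theorem Exp.compile_op {v w : ℕ → Store → Env → ℕ} {op : ℕ → ℕ → ℕ} {d : ℕ}
    (mk : ℕ → ℕ → ℕ → Prog)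
    (hmk : ∀ x y z s, Exec (mk x y z) s 1 (s.setReg x (op (s.reg y) (s.reg z)))) (hd : 1 ≤ d)
    (hv : ∀ d, 1 ≤ d → ∃ P p, Evaluates P p d v) (hw : ∀ d, 1 ≤ d → ∃ P p, Evaluates P p d w) :
    ∃ P p, Evaluates P p d fun N A η => op (v N A η) (w N A η) := by
  obtain ⟨P, p, hP⟩ := hv d hd
  obtain ⟨Q, q, hQ⟩ := hw (d + 1) (by omega)
  refine ⟨.seq P (.seq Q (mk (4 * d) (4 * d) (4 * (d + 1)))), p + q + 1, fun s => ?_⟩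
  obtain ⟨t, s₁, h₁, ht, hv, ha, hs⟩ := hP s
  obtain ⟨u, s₂, h₂, hu, hw, hb, hs'⟩ := hQ s₁
  have h0 : s₁.reg 0 = s.reg 0 := hs 0 (by omega)
  refine ⟨_, _, .seq h₁ (.seq h₂ (hmk ..)), ?_, ?_, ?_, ?_⟩
  · rw [h0] at hu
    simp only [Polynomial.eval_add, Polynomial.eval_one]
    omega
  · have : s₂.reg (4 * d) = s₁.reg (4 * d) := hs' _ (by omega)
    simp only [State.setReg, Function.update_self, this, hv, hw, h0, ha, hs.env_eq]
  · simp [State.setReg, ha, hb]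
  · intro r hr
    have h1 : r ≠ 4 * d := by omega
    simp only [State.setReg, Function.update_of_ne h1]
    rw [hs' r (by omega), hs r hr]

/-- An expression is evaluated into temporary register `4 d` in time polynomial in the bound `N`,
which is kept in register `0`. -/
theorem Exp.compile (e : Exp) : ∀ d, 1 ≤ d →
    ∃ P p, Evaluates P p d fun N A η => e.eval N A η := by
  have hne : ∀ {d i : ℕ}, i % 4 ≠ 0 ∨ i < 4 * d → i ≠ 4 * d := by intros; omega
  induction e with
  | var x =>
    intro d hd
    refine ⟨.seq (.const (4 * d) 0) (.add (4 * d) x.code (4 * d)), 2, fun s =>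
      ⟨_, _, .seq (.const ..) (.add ..), by simp, ?_, rfl, ?_⟩⟩
    · have := x.code_mod
      have h : x.code ≠ 4 * d := by omega
      simp [State.setReg, Exp.eval, RAM.State.env, h]
    · intro r hr
      simp [State.setReg, hne hr]
  | const c =>
    intro d hd
    refine ⟨.const (4 * d) c, 1, fun s => ⟨_, _, .const .., by simp, ?_, rfl, ?_⟩⟩
    · simp [State.setReg, Exp.eval]
    · intro r hr
      simp [State.setReg, hne hr]
  | add e f ihe ihf => exact fun d hd => compile_op .add (fun _ _ _ _ => .add ..) hd ihe ihf
  | sub e f ihe ihf => exact fun d hd => compile_op .sub (fun _ _ _ _ => .sub ..) hd ihe ihf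
  | get a i ih =>
    intro d hd
    obtain ⟨P, p, hP⟩ := ih d hd
    refine ⟨.seq P (.load (4 * d) a (4 * d)), p + 1, fun s => ?_⟩
    obtain ⟨t, s₁, h₁, ht, hv, ha, hs⟩ := hP s
    refine ⟨_, _, .seq h₁ (.load ..), by simpa using ht, ?_, ?_, ?_⟩
    · simp [State.setReg, Exp.eval, hv, ha]
    · simp [State.setReg, ha]
    · intro r hr
      simp only [State.setReg, Function.update_of_ne (hne hr)]
      exact hs r hr
  | sum x e ih =>
    intro d hd
    obtain ⟨P, p, hP⟩ := ih (d + 3) (by omega)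
    have hx := x.code_mod
    refine ⟨.seq (.const (4 * d) 0) (.seq (.add (4 * (d + 1)) x.code (4 * d))
      (.seq (.add (4 * (d + 2)) 0 (4 * d)) (.seq (.loop (4 * (d + 2))
        (.seq (.sub x.code 0 (4 * (d + 2))) (.seq P (.seq (.add (4 * d) (4 * d) (4 * (d + 3)))
          (.seq (.const (4 * (d + 3)) 1)
            (.sub (4 * (d + 2)) (4 * (d + 2)) (4 * (d + 3))))))))
        (.seq (.const (4 * (d + 3)) 0) (.add x.code (4 * (d + 1)) (4 * (d + 3))))))),
      .X * (p + 5) + 6, fun s => ?_⟩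
    set N := s.reg 0 with hN
    -- With `j` rounds to go, the first `N - j` terms have been added up.
    let I : ℕ → State → Prop := fun j s' => j ≤ N ∧ s'.arr = s.arr ∧
      (∀ r, r ≠ x.code ∧ (r % 4 ≠ 0 ∨ r < 4 * d) → s'.reg r = s.reg r) ∧
      s'.reg (4 * (d + 1)) = s.reg x.code ∧
      s'.reg (4 * d) = ∑ i ∈ Finset.range (N - j), e.eval N s.arr (Function.update s.env x i)
    obtain ⟨t, s₂, h₂, ht, -, ha, hr, hsav, hacc⟩ := exec_countdown (r := 4 * (d + 2))
      (body := .seq (.sub x.code 0 (4 * (d + 2))) (.seq P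
        (.seq (.add (4 * d) (4 * d) (4 * (d + 3))) (.seq (.const (4 * (d + 3)) 1)
            (.sub (4 * (d + 2)) (4 * (d + 2)) (4 * (d + 3)))))))
      (T := p.eval N + 4) I (by
        rintro j s₁ ⟨hj, ha, hr, hsav, hacc⟩ hc
        obtain ⟨t, s₂, h₂, ht, hv, hb, hs⟩ :=
          hP (s₁.setReg x.code (s₁.reg 0 - s₁.reg (4 * (d + 2))))
        have h0 : s₁.reg 0 = N := hr 0 (by omega)
        refine ⟨_, _, .seq (.sub ..) (.seq h₂ (.seq (.add ..) (.seq (.const ..) (.sub ..)))),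
          ?_, ⟨by omega, ?_, ?_, ?_, ?_⟩, ?_⟩
        · have : (s₁.setReg x.code (s₁.reg 0 - s₁.reg (4 * (d + 2)))).reg 0 = N := by
            have hx0 : 0 ≠ x.code := by omega
            simp only [State.setReg, Function.update_of_ne hx0, h0]
          rw [this] at ht
          omega
        · simpa [State.setReg, hb] using ha
        · intro r hr'
          have h1 : r ≠ 4 * (d + 2) := by omega
          have h2 : r ≠ 4 * (d + 3) := by omega
          have h3 : r ≠ 4 * d := by omega
          have h4 : r ≠ x.code := by omega
          have := hs r (by omega)
          simp only [State.setReg, Function.update_of_ne, h1, h2, h3, h4, ne_eq,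
            not_false_eq_true] at this ⊢
          rw [this, hr r hr']
        · have h1 : 4 * (d + 1) ≠ 4 * (d + 2) := by omega
          have h2 : 4 * (d + 1) ≠ 4 * (d + 3) := by omega
          have h3 : 4 * (d + 1) ≠ 4 * d := by omega
          have h4 : 4 * (d + 1) ≠ x.code := by omega
          have := hs (4 * (d + 1)) (by omega)
          simp only [State.setReg, Function.update_of_ne, h1, h2, h3, h4, ne_eq,
            not_false_eq_true] at this ⊢
          rw [this, hsav]
        · have h1 : 4 * d ≠ 4 * (d + 2) := by omega
          have h2 : 4 * d ≠ 4 * (d + 3) := by omega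
          have h4 : 4 * d ≠ x.code := by omega
          have h5 : 0 ≠ x.code := by omega
          have := hs (4 * d) (by omega)
          rw [RAM.State.env_setReg] at hv
          simp only [State.setReg, Function.update_of_ne, h1, h2, h4, h5, ne_eq,
            not_false_eq_true, Function.update_self] at this hv ⊢
          have h6 : N - j = N - (j + 1) + 1 := by omega
          rw [this, hv, hacc, h6, Finset.sum_range_succ, ha, h0, hc]
          congr 2
          funext y
          by_cases hy : y = x
          · subst hy; simp
          · simp only [Function.update_of_ne hy, RAM.State.env]
            exact hr _ ⟨fun h => hy (Name.code_injective h), Or.inl y.code_mod⟩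
        · have h1 : 4 * (d + 2) ≠ 4 * (d + 3) := by omega
          have h3 : 4 * (d + 2) ≠ 4 * d := by omega
          have h4 : 4 * (d + 2) ≠ x.code := by omega
          have := hs (4 * (d + 2)) (by omega)
          simp only [State.setReg, Function.update_of_ne, h1, h3, h4, ne_eq,
            not_false_eq_true, Function.update_self] at this ⊢
          omega)
      N (((s.setReg (4 * d) 0).setReg (4 * (d + 1)) (s.reg x.code)).setReg (4 * (d + 2)) N)
      (by
        refine ⟨le_rfl, rfl, ?_, ?_, ?_⟩
        · intro r hr
          have h1 : r ≠ 4 * (d + 2) := by omega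
          have h2 : r ≠ 4 * (d + 1) := by omega
          have h3 : r ≠ 4 * d := by omega
          simp [State.setReg, h1, h2, h3]
        · have h1 : 4 * (d + 1) ≠ 4 * (d + 2) := by omega
          simp [State.setReg]
        · simp [State.setReg])
      (by simp [State.setReg])
    refine ⟨_, _, .seq (.const ..) (.seq (.add ..) (.seq (.add ..) (.seq (t₁ := t) (s₁ := s₂) ?_
      (.seq (.const ..) (.add ..))))), ?_, ?_, ?_, ?_⟩
    · convert h₂ using 2
      · have h1 : x.code ≠ 4 * d := by omega
        simp [State.setReg, h1]
      · have h1 : 0 ≠ 4 * (d + 1) := by omega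
        have h2 : 0 ≠ 4 * d := by omega
        have h3 : 4 * d ≠ 4 * (d + 1) := by omega
        simp only [State.setReg, Function.update_of_ne, h1, h2, h3, ne_eq, not_false_eq_true,
          Function.update_self, ← hN, Nat.add_zero]
    · simp only [Polynomial.eval_add, Polynomial.eval_mul, Polynomial.eval_X,
        Polynomial.eval_ofNat]
      rw [show p.eval N + 4 + 1 = p.eval N + 5 by ring] at ht
      omega
    · have h1 : 4 * d ≠ x.code := by omega
      have h2 : 4 * d ≠ 4 * (d + 3) := by omega
      simp only [State.setReg, Function.update_of_ne, h1, h2, ne_eq, not_false_eq_true, hacc,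
        Nat.sub_zero, Exp.eval]
    · simpa [State.setReg] using ha
    · intro r hr'
      have h2 : r ≠ 4 * (d + 3) := by omega
      have h3 : 4 * (d + 1) ≠ 4 * (d + 3) := by omega
      by_cases h1 : r = x.code
      · subst h1
        simp only [State.setReg, Function.update_of_ne, h3, ne_eq, not_false_eq_true,
          Function.update_self, hsav, Nat.add_zero]
      · simp only [State.setReg, Function.update_of_ne, h1, h2, ne_eq, not_false_eq_true]
        exact hr r (by omega)

/-- A command is executed in time polynomial in the bound `N`, which is kept in register `0`. -/
theorem Cmd.compile (c : Cmd) : ∀ d, 1 ≤ d → ∃ (P : Prog) (p : Polynomial ℕ), ∀ s : State,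
    ∃ t s', Exec P s t s' ∧ t ≤ p.eval (s.reg 0) ∧ s'.arr = c.run (s.reg 0) s.env s.arr ∧
      s.AgreesBelow d s' := by
  induction c with
  | skip =>
    intro d hd
    refine ⟨.const (4 * d) 0, 1, fun s => ⟨_, _, .const .., by simp, rfl, ?_⟩⟩
    intro r hr
    have h1 : r ≠ 4 * d := by omega
    simp [State.setReg, h1]
  | put a i e =>
    intro d hd
    obtain ⟨P, p, hP⟩ := i.compile d hd
    obtain ⟨Q, q, hQ⟩ := e.compile (d + 1) (by omega)
    refine ⟨.seq P (.seq Q (.store a (4 * d) (4 * (d + 1)))), p + q + 1, fun s => ?_⟩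
    obtain ⟨t, s₁, h₁, ht, hv, ha, hs⟩ := hP s
    obtain ⟨u, s₂, h₂, hu, hw, hb, hs'⟩ := hQ s₁
    have h0 : s₁.reg 0 = s.reg 0 := hs 0 (by omega)
    refine ⟨_, _, .seq h₁ (.seq h₂ (.store ..)), ?_, ?_, ?_⟩
    · rw [h0] at hu
      simp only [Polynomial.eval_add, Polynomial.eval_one]
      omega
    · have : s₂.reg (4 * d) = s₁.reg (4 * d) := hs' _ (by omega)
      simp only [State.setArr, Cmd.run, this, hv, hw, h0, ha, hb, hs.env_eq]
    · intro r hr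
      simp only [State.setArr]
      rw [hs' r (by omega), hs r hr]
  | seq c c' ih ih' =>
    intro d hd
    obtain ⟨P, p, hP⟩ := ih d hd
    obtain ⟨Q, q, hQ⟩ := ih' d hd
    refine ⟨.seq P Q, p + q, fun s => ?_⟩
    obtain ⟨t, s₁, h₁, ht, ha, hs⟩ := hP s
    obtain ⟨u, s₂, h₂, hu, hb, hs'⟩ := hQ s₁
    have h0 : s₁.reg 0 = s.reg 0 := hs 0 (by omega)
    refine ⟨_, _, .seq h₁ h₂, ?_, ?_, fun r hr => (hs' r hr).trans (hs r hr)⟩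
    · rw [h0] at hu
      simp only [Polynomial.eval_add]
      omega
    · rw [hb, ha, h0, hs.env_eq, Cmd.run]
  | ifnz e c ih =>
    intro d hd
    obtain ⟨P, p, hP⟩ := e.compile d hd
    obtain ⟨Q, q, hQ⟩ := ih d hd
    refine ⟨.seq P (.cond (4 * d) Q (.const (4 * d) 0)), p + q + 2, fun s => ?_⟩
    obtain ⟨t, s₁, h₁, ht, hv, ha, hs⟩ := hP s
    have h0 : s₁.reg 0 = s.reg 0 := hs 0 (by omega)
    by_cases h : e.eval (s.reg 0) s.arr s.env = 0
    · refine ⟨_, _, .seq h₁ (.condFalse (by simp [hv, h]) (.const ..)), ?_, ?_, ?_⟩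
      · simp only [Polynomial.eval_add, Polynomial.eval_ofNat]
        omega
      · simp [State.setReg, Cmd.run, h, ha]
      · intro r hr
        have h1 : r ≠ 4 * d := by omega
        simp only [State.setReg, Function.update_of_ne h1]
        exact hs r hr
    · obtain ⟨u, s₂, h₂, hu, hb, hs'⟩ := hQ s₁
      refine ⟨_, _, .seq h₁ (.condTrue (by simpa [hv] using h) h₂), ?_, ?_,
        fun r hr => (hs' r hr).trans (hs r hr)⟩
      · rw [h0] at hu
        simp only [Polynomial.eval_add, Polynomial.eval_ofNat]
        omega
      · rw [hb, ha, h0, hs.env_eq, Cmd.run, if_pos h]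
  | loop x c ih =>
    intro d hd
    obtain ⟨P, p, hP⟩ := ih (d + 3) (by omega)
    have hx := x.code_mod
    refine ⟨.seq (.const (4 * (d + 1)) 0) (.seq (.add (4 * d) x.code (4 * (d + 1)))
      (.seq (.add (4 * (d + 1)) 0 (4 * (d + 1))) (.seq (.loop (4 * (d + 1))
        (.seq (.sub x.code 0 (4 * (d + 1))) (.seq P (.seq (.const (4 * (d + 2)) 1)
            (.sub (4 * (d + 1)) (4 * (d + 1)) (4 * (d + 2)))))))
        (.seq (.const (4 * (d + 2)) 0) (.add x.code (4 * d) (4 * (d + 2))))))),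
      .X * (p + 4) + 6, fun s => ?_⟩
    set N := s.reg 0 with hN
    -- With `j` rounds to go, the rounds for `0, …, N - j - 1` have been carried out.
    let I : ℕ → State → Prop := fun j s' => j ≤ N ∧
      (∀ r, r ≠ x.code ∧ (r % 4 ≠ 0 ∨ r < 4 * d) → s'.reg r = s.reg r) ∧
      s'.reg (4 * d) = s.reg x.code ∧
      s'.arr = (List.range (N - j)).foldl
        (fun A i => c.run N (Function.update s.env x i) A) s.arr
    obtain ⟨t, s₂, h₂, ht, -, hr, hsav, ha⟩ := exec_countdown (r := 4 * (d + 1))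
      (body := .seq (.sub x.code 0 (4 * (d + 1))) (.seq P (.seq (.const (4 * (d + 2)) 1)
            (.sub (4 * (d + 1)) (4 * (d + 1)) (4 * (d + 2))))))
      (T := p.eval N + 3) I (by
        rintro j s₁ ⟨hj, hr, hsav, ha⟩ hc
        obtain ⟨t, s₂, h₂, ht, hb, hs⟩ := hP (s₁.setReg x.code (s₁.reg 0 - s₁.reg (4 * (d + 1))))
        have h0 : s₁.reg 0 = N := hr 0 (by omega)
        have h0' : (s₁.setReg x.code (s₁.reg 0 - s₁.reg (4 * (d + 1)))).reg 0 = N := by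
          have hx0 : 0 ≠ x.code := by omega
          simp only [State.setReg, Function.update_of_ne hx0, h0]
        refine ⟨_, _, .seq (.sub ..) (.seq h₂ (.seq (.const ..) (.sub ..))),
          ?_, ⟨by omega, ?_, ?_, ?_⟩, ?_⟩
        · rw [h0'] at ht
          omega
        · intro r hr'
          have h1 : r ≠ 4 * (d + 1) := by omega
          have h2 : r ≠ 4 * (d + 2) := by omega
          have h4 : r ≠ x.code := by omega
          have := hs r (by omega)
          simp only [State.setReg, Function.update_of_ne, h1, h2, h4, ne_eq,
            not_false_eq_true] at this ⊢
          rw [this, hr r hr']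
        · have h1 : 4 * d ≠ 4 * (d + 1) := by omega
          have h2 : 4 * d ≠ 4 * (d + 2) := by omega
          have h4 : 4 * d ≠ x.code := by omega
          have := hs (4 * d) (by omega)
          simp only [State.setReg, Function.update_of_ne, h1, h2, h4, ne_eq,
            not_false_eq_true] at this ⊢
          rw [this, hsav]
        · rw [h0', RAM.State.env_setReg] at hb
          simp only [State.setReg] at hb ⊢
          have h6 : N - j = N - (j + 1) + 1 := by omega
          rw [hb, h6, List.range_succ, List.foldl_append, ← ha, h0, hc]
          simp only [List.foldl_cons, List.foldl_nil]
          congr 1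
          funext y
          by_cases hy : y = x
          · subst hy; simp
          · simp only [Function.update_of_ne hy, RAM.State.env]
            exact hr _ ⟨fun h => hy (Name.code_injective h), Or.inl y.code_mod⟩
        · have h1 : 4 * (d + 1) ≠ 4 * (d + 2) := by omega
          have h4 : 4 * (d + 1) ≠ x.code := by omega
          have := hs (4 * (d + 1)) (by omega)
          simp only [State.setReg, Function.update_of_ne, h1, h4, ne_eq,
            not_false_eq_true, Function.update_self] at this ⊢
          omega)
      N (((s.setReg (4 * (d + 1)) 0).setReg (4 * d) (s.reg x.code)).setReg (4 * (d + 1)) N)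
      (by
        refine ⟨le_rfl, ?_, ?_, ?_⟩
        · intro r hr
          have h1 : r ≠ 4 * (d + 1) := by omega
          have h3 : r ≠ 4 * d := by omega
          simp [State.setReg, h1, h3]
        · simp [State.setReg]
        · simp [State.setReg])
      (by simp [State.setReg])
    refine ⟨_, _, .seq (.const ..) (.seq (.add ..) (.seq (.add ..) (.seq (t₁ := t) (s₁ := s₂) ?_
      (.seq (.const ..) (.add ..))))), ?_, ?_, ?_⟩
    · convert h₂ using 2
      · have h1 : x.code ≠ 4 * (d + 1) := by omega
        simp [State.setReg, h1]
      · have h1 : 0 ≠ 4 * (d + 1) := by omega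
        have h2 : 0 ≠ 4 * d := by omega
        have h3 : 4 * (d + 1) ≠ 4 * d := by omega
        simp only [State.setReg, Function.update_of_ne, h1, h2, h3, ne_eq, not_false_eq_true,
          Function.update_self, ← hN, Nat.add_zero]
    · simp only [Polynomial.eval_add, Polynomial.eval_mul, Polynomial.eval_X,
        Polynomial.eval_ofNat]
      rw [show p.eval N + 3 + 1 = p.eval N + 4 by ring] at ht
      omega
    · simp only [State.setReg, ha, Nat.sub_zero, Cmd.run]
    · intro r hr'
      have h2 : r ≠ 4 * (d + 2) := by omega
      have h3 : 4 * d ≠ 4 * (d + 2) := by omega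
      by_cases h1 : r = x.code
      · subst h1
        simp only [State.setReg, Function.update_of_ne, h3, ne_eq, not_false_eq_true,
          Function.update_self, hsav, Nat.add_zero]
      · simp only [State.setReg, Function.update_of_ne, h1, h2, ne_eq, not_false_eq_true]
        exact hr r (by omega)

/-- A command becomes a program of the machine that runs in polynomial time on graphs and returns
entry `0` of array `a` in register `0`. The bound of the loops is one more than the number of
vertices, so that all cardinalities of sets of vertices are in the range of the loops, and one of
the numbers below the bound is not a vertex. -/
theorem Cmd.exists_prog (c : Cmd) (a : ℕ) : ∃ (P : Prog) (p : Polynomial ℕ),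
    ∀ (n : ℕ) (G : SimpleGraph (Fin n)), ∃ t s, Exec P (graphInput G) t s ∧ t ≤ p.eval n ∧
      s.arr = c.run (n + 1) (fun _ => 0) (graphInput G).arr ∧ s.reg 0 = s.arr a 0 := by
  obtain ⟨P, p, hP⟩ := c.compile 2 (by omega)
  refine ⟨.seq (.const 4 1) (.seq (.add 0 0 4) (.seq P (.seq (.const 0 0) (.load 0 a 0)))),
    p.comp (.X + 1) + 4, fun n G => ?_⟩
  obtain ⟨t, s, he, ht, hs, -⟩ := hP (((graphInput G).setReg 4 1).setReg 0 (n + 1))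
  refine ⟨_, _, .seq (.const ..) (.seq (.add ..) (.seq (t₁ := t) (s₁ := s) ?_
    (.seq (.const ..) (.load ..)))), ?_, ?_, ?_⟩
  · convert he using 2
    simp [State.setReg, graphInput]
  · simp only [State.setReg, Function.update_self] at ht
    simp only [Polynomial.eval_add, Polynomial.eval_comp, Polynomial.eval_X, Polynomial.eval_one,
      Polynomial.eval_ofNat]
    omega
  · rw [show (((s.setReg 0 0).setReg 0 _).arr = s.arr) from rfl, hs]
    simp only [State.setReg, Function.update_self]
    congr 1
    funext x
    have := x.code_mod
    have h0 : x.code ≠ 0 := by intro h; simp [h] at this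
    have h4 : x.code ≠ 4 := by intro h; simp [h] at this
    simp [RAM.State.env, graphInput, h0, h4]
  · simp [State.setReg]

/-! ### Logical connectives and arithmetic in the language -/

namespace Exp

variable {N : ℕ} {A : Store} {η : Env}

/-- Read as a formula, an expression holds if its value is not zero. -/
def Holds (N : ℕ) (A : Store) (η : Env) (e : Exp) : Prop := e.eval N A η ≠ 0

/-- Negation. -/
def not (e : Exp) : Exp := .sub (.const 1) e

/-- Disjunction. -/
def or (e f : Exp) : Exp := .add e f

/-- Conjunction. -/
def and (e f : Exp) : Exp := not (or (not e) (not f))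

/-- The formula `e < f`. -/
def lt (e f : Exp) : Exp := .sub f e

/-- The formula `e = f`. -/
def eq (e f : Exp) : Exp := not (or (lt e f) (lt f e))

/-- Sum over a finite type of indices. -/
noncomputable def fsum {ι : Type} [Fintype ι] (e : ι → Exp) : Exp :=
  (Finset.univ.toList.map e).foldr .add (.const 0)

/-- Conjunction over a finite type of indices. -/
noncomputable def fall {ι : Type} [Fintype ι] (e : ι → Exp) : Exp := not (fsum fun i => not (e i))

/-- Bounded existential quantifier `∃ x < N, e`. -/
def ex (x : Name) (e : Exp) : Exp := .sum x e

/-- Bounded universal quantifier `∀ x < N, e`. -/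
def all (x : Name) (e : Exp) : Exp := not (.sum x (not e))

@[simp] theorem holds_not {e : Exp} : (not e).Holds N A η ↔ ¬ e.Holds N A η := by
  simp only [Holds, not, eval]
  omega

@[simp] theorem holds_or {e f : Exp} : (or e f).Holds N A η ↔ e.Holds N A η ∨ f.Holds N A η := by
  simp only [Holds, or, eval]
  omega

@[simp] theorem holds_and {e f : Exp} : (and e f).Holds N A η ↔ e.Holds N A η ∧ f.Holds N A η := by
  simp [and]

@[simp] theorem holds_lt {e f : Exp} :
    (lt e f).Holds N A η ↔ e.eval N A η < f.eval N A η := by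
  simp only [Holds, lt, eval]
  omega

@[simp] theorem holds_eq {e f : Exp} :
    (eq e f).Holds N A η ↔ e.eval N A η = f.eval N A η := by
  simp only [eq, holds_not, holds_or, holds_lt]
  omega

@[simp] theorem holds_get {a : ℕ} {i : Exp} :
    (get a i).Holds N A η ↔ A a (i.eval N A η) ≠ 0 := Iff.rfl

@[simp] theorem eval_fsum {ι : Type} [Fintype ι] (e : ι → Exp) :
    (fsum e).eval N A η = ∑ i, (e i).eval N A η := by
  have h : ∀ l : List ι, ((l.map e).foldr Exp.add (.const 0)).eval N A η =
      (l.map fun i => (e i).eval N A η).sum := by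
    intro l
    induction l with
    | nil => rfl
    | cons i l ih => simp only [List.map_cons, List.foldr_cons, eval, ih, List.sum_cons]
  rw [fsum, h, Finset.sum_map_toList]

@[simp] theorem holds_fall {ι : Type} [Fintype ι] (e : ι → Exp) :
    (fall e).Holds N A η ↔ ∀ i, (e i).Holds N A η := by
  have h : ∀ i, (not (e i)).eval N A η = 0 ↔ (e i).Holds N A η := by
    intro i
    simp only [Holds, not, eval]
    omega
  simp only [fall, holds_not]
  simp only [Holds, eval_fsum, ne_eq, not_not, Finset.sum_eq_zero_iff, Finset.mem_univ,
    forall_const, h]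

@[simp] theorem holds_ex {x : Name} {e : Exp} :
    (ex x e).Holds N A η ↔ ∃ i < N, e.Holds N A (Function.update η x i) := by
  simp only [Holds, ex, eval, ne_eq, Finset.sum_eq_zero_iff, Finset.mem_range, not_forall,
    exists_prop]

@[simp] theorem holds_all {x : Name} {e : Exp} :
    (all x e).Holds N A η ↔ ∀ i < N, e.Holds N A (Function.update η x i) := by
  have := holds_ex (N := N) (A := A) (η := η) (x := x) (e := not e)
  simp only [ex] at this
  simp [all, this]

/-- The characteristic value of a formula, used to count. -/
def ind (e : Exp) : Exp := not (not e)

open Classical in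
@[simp] theorem eval_ind {e : Exp} : (ind e).eval N A η = if e.Holds N A η then 1 else 0 := by
  by_cases h : e.eval N A η = 0
  · simp [ind, not, eval, Holds, h]
  · simp only [ind, not, eval, Holds, ne_eq, h, not_false_eq_true, if_true]
    omega

/-- Multiplication by the bound `N`. The factor must not depend on the variable `aux 0`. -/
def mulBound (e : Exp) : Exp := .sum (.aux 0) e

theorem eval_mulBound {e : Exp}
    (h : ∀ i, e.eval N A (Function.update η (.aux 0) i) = e.eval N A η) :
    (mulBound e).eval N A η = e.eval N A η * N := by
  simp only [mulBound, eval, h, Finset.sum_const, Finset.card_range, smul_eq_mul, mul_comm]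

end Exp

/-! ### Blocks of nested loops and quantifiers -/

/-- The assignments that arise from `η` by giving values below `N` to the variables in `xs`. -/
def Box (N : ℕ) (xs : List Name) (η : Env) : Set Env :=
  {ζ | (∀ x, x ∉ xs → ζ x = η x) ∧ ∀ x ∈ xs, ζ x < N}

theorem box_nil (N : ℕ) (η : Env) : Box N [] η = {η} := by
  ext ζ
  simp [Box, funext_iff]

theorem mem_box_cons {N : ℕ} {x : Name} {xs : List Name} {η ζ : Env} :
    ζ ∈ Box N (x :: xs) η ↔ ∃ i < N, ζ ∈ Box N xs (Function.update η x i) := by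
  constructor
  · rintro ⟨h, h'⟩
    refine ⟨ζ x, h' x (by simp), fun y hy => ?_, fun y hy => h' y (by simp [hy])⟩
    by_cases hyx : y = x
    · subst hyx; simp
    · rw [Function.update_of_ne hyx]
      exact h y (by simp [hy, hyx])
  · rintro ⟨i, hi, h, h'⟩
    refine ⟨fun y hy => ?_, fun y hy => ?_⟩
    · simp only [List.mem_cons, not_or] at hy
      rw [h y hy.2, Function.update_of_ne hy.1]
    · by_cases hyx : y ∈ xs
      · exact h' y hyx
      · obtain rfl : y = x := by simpa [hyx] using hy
        rw [h y hyx]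
        simpa using hi

/-- A block of bounded existential quantifiers. -/
def Exp.exs (xs : List Name) (e : Exp) : Exp := xs.foldr Exp.ex e

@[simp] theorem Exp.holds_exs {N : ℕ} {A : Store} {xs : List Name} {e : Exp} {η : Env} :
    (Exp.exs xs e).Holds N A η ↔ ∃ ζ ∈ Box N xs η, e.Holds N A ζ := by
  induction xs generalizing η with
  | nil => simp [Exp.exs, box_nil]
  | cons x xs ih =>
    have h : (Exp.exs (x :: xs) e) = Exp.ex x (Exp.exs xs e) := rfl
    simp only [h, Exp.holds_ex, ih, mem_box_cons]
    constructor
    · rintro ⟨i, hi, ζ, hζ, h⟩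
      exact ⟨ζ, ⟨i, hi, hζ⟩, h⟩
    · rintro ⟨ζ, ⟨i, hi, hζ⟩, h⟩
      exact ⟨i, hi, ζ, hζ, h⟩

namespace Cmd

variable {N : ℕ}

/-- A block of nested loops. -/
def loops (xs : List Name) (c : Cmd) : Cmd := xs.foldr Cmd.loop c

theorem run_ifnz_of_holds {e : Exp} {c : Cmd} {η : Env} {A : Store} (h : e.Holds N A η) :
    (ifnz e c).run N η A = c.run N η A := if_pos h

theorem run_ifnz_of_not_holds {e : Exp} {c : Cmd} {η : Env} {A : Store} (h : ¬ e.Holds N A η) :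
    (ifnz e c).run N η A = A := if_neg h

@[simp] theorem loops_nil (c : Cmd) : loops [] c = c := rfl

/-- The command contains no assignment to the array `a`. -/
def Preserves (a : ℕ) : Cmd → Prop
  | skip => True
  | put b _ _ => a ≠ b
  | seq c c' => c.Preserves a ∧ c'.Preserves a
  | ifnz _ c => c.Preserves a
  | loop _ c => c.Preserves a

theorem Preserves.run_eq {a : ℕ} {c : Cmd} (h : c.Preserves a) (η : Env) (A : Store) :
    c.run N η A a = A a := by
  induction c generalizing η A with
  | skip => rfl
  | put b i e => exact Function.update_of_ne h _ _
  | seq c c' ih ih' => rw [run, ih' h.2, ih h.1]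
  | ifnz e c ih =>
    rw [run]
    split_ifs
    · exact ih h _ _
    · rfl
  | loop x c ih =>
    rw [run]
    induction List.range N generalizing A with
    | nil => rfl
    | cons i l ihl => rw [List.foldl_cons, ihl, ih h]

@[simp] theorem preserves_loops {a : ℕ} {xs : List Name} {c : Cmd} :
    (loops xs c).Preserves a ↔ c.Preserves a := by
  induction xs with
  | nil => rfl
  | cons x xs ih => exact ih

/-- The array `A'` arises from `A` by assigning `v ζ` to entry `k ζ` of array `a`, for each `ζ` in
`W`, in some order. -/
def Filled (a : ℕ) (W : Set Env) (k v : Env → ℕ) (A A' : Store) : Prop :=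
  (∀ b, b ≠ a → A' b = A b) ∧
    ∀ p, (∃ ζ ∈ W, k ζ = p ∧ A' a p = v ζ) ∨ (A' a p = A a p ∧ ∀ ζ ∈ W, k ζ ≠ p)

theorem Filled.union {a : ℕ} {W W' : Set Env} {k v : Env → ℕ} {A A' A'' : Store}
    (h : Filled a W k v A A') (h' : Filled a W' k v A' A'') : Filled a (W ∪ W') k v A A'' := by
  refine ⟨fun b hb => (h'.1 b hb).trans (h.1 b hb), fun p => ?_⟩
  rcases h'.2 p with ⟨ζ, hζ, hk, hv⟩ | ⟨h₁, h₂⟩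
  · exact Or.inl ⟨ζ, Or.inr hζ, hk, hv⟩
  · rcases h.2 p with ⟨ζ, hζ, hk, hv⟩ | ⟨h₃, h₄⟩
    · exact Or.inl ⟨ζ, Or.inl hζ, hk, h₁.trans hv⟩
    · refine Or.inr ⟨h₁.trans h₃, ?_⟩
      rintro ζ (hζ | hζ)
      exacts [h₄ ζ hζ, h₂ ζ hζ]

theorem Filled.apply {a : ℕ} {W : Set Env} {k v : Env → ℕ} {A A' : Store}
    (h : Filled a W k v A A') (hk : ∀ ζ ∈ W, ∀ ξ ∈ W, k ζ = k ξ → v ζ = v ξ) {ζ : Env}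
    (hζ : ζ ∈ W) : A' a (k ζ) = v ζ := by
  rcases h.2 (k ζ) with ⟨ξ, hξ, hkξ, hv⟩ | ⟨-, h'⟩
  · rw [hv, hk ξ hξ ζ hζ hkξ]
  · exact absurd rfl (h' ζ hζ)

theorem Filled.apply_of_ne {a : ℕ} {W : Set Env} {k v : Env → ℕ} {A A' : Store}
    (h : Filled a W k v A A') {p : ℕ} (hp : ∀ ζ ∈ W, k ζ ≠ p) : A' a p = A a p := by
  rcases h.2 p with ⟨ξ, hξ, hkξ, -⟩ | ⟨h', -⟩
  · exact absurd hkξ (hp ξ hξ)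
  · exact h'

/-- Nested loops around an assignment to an array that is not read fill this array. -/
theorem filled_loops_put {a : ℕ} {xs : List Name} {i e : Exp} {η : Env} {k v : Env → ℕ} {A₀ : Store}
    (h : ∀ ζ ∈ Box N xs η, ∀ A : Store, (∀ b, b ≠ a → A b = A₀ b) →
      i.eval N A ζ = k ζ ∧ e.eval N A ζ = v ζ)
    {A : Store} (hA : ∀ b, b ≠ a → A b = A₀ b) :
    Filled a (Box N xs η) k v A ((loops xs (.put a i e)).run N η A) := by
  induction xs generalizing η A with
  | nil =>
    obtain ⟨hi, he⟩ := h η (by simp [box_nil]) A hA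
    refine ⟨fun b hb => by simp [run, hb], fun p => ?_⟩
    by_cases hp : k η = p
    · exact Or.inl ⟨η, by simp [box_nil], hp, by simp [run, hi, he, hp]⟩
    · exact Or.inr ⟨by simp [run, hi, Ne.symm hp], by simpa [box_nil] using hp⟩
  | cons x xs ih =>
    have key : ∀ m ≤ N, Filled a {ζ | ∃ i < m, ζ ∈ Box N xs (Function.update η x i)} k v A
        ((List.range m).foldl
          (fun A j => (loops xs (.put a i e)).run N (Function.update η x j) A) A) := by
      intro m hm
      induction m with
      | zero => exact ⟨fun b _ => rfl, fun p => Or.inr ⟨rfl, by simp⟩⟩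
      | succ m ihm =>
        have h₁ := ihm (by omega)
        have h₂ := ih (η := Function.update η x m)
          (fun ζ hζ => h ζ (mem_box_cons.2 ⟨m, hm, hζ⟩))
          (fun b hb => (h₁.1 b hb).trans (hA b hb))
        rw [List.range_succ, List.foldl_append, List.foldl_cons, List.foldl_nil]
        convert h₁.union h₂ using 1
        ext ζ
        simp only [Set.mem_ofPred_eq, Set.mem_union, Nat.lt_succ_iff_lt_or_eq]
        constructor
        · rintro ⟨i, hi | rfl, hζ⟩
          exacts [Or.inl ⟨i, hi, hζ⟩, Or.inr hζ]
        · rintro (⟨i, hi, hζ⟩ | hζ)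
          exacts [⟨i, Or.inl hi, hζ⟩, ⟨m, Or.inr rfl, hζ⟩]
    rw [show Box N (x :: xs) η = _ from Set.ext fun ζ => mem_box_cons]
    exact key N le_rfl

/-- Nested loops whose body either decreases a measure or leaves the represented object as it is,
because a condition holds. If the measure has not decreased at the end, the condition holds for all
values of the loop variables. -/
theorem run_loops_measure {α : Type*} (R : Store → α → Prop) (μ : α → ℕ) {xs : List Name} {c : Cmd}
    {η : Env} (Q : Env → α → Prop)
    (h : ∀ ζ ∈ Box N xs η, ∀ A a, R A a →
      ∃ a', R (c.run N ζ A) a' ∧ (μ a' < μ a ∨ a' = a ∧ Q ζ a))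
    {A : Store} {a : α} (hA : R A a) :
    ∃ a', R ((loops xs c).run N η A) a' ∧
      (μ a' < μ a ∨ a' = a ∧ ∀ ζ ∈ Box N xs η, Q ζ a) := by
  induction xs generalizing η A a with
  | nil => simpa [box_nil] using h η (by simp [box_nil]) A a hA
  | cons x xs ih =>
    have key : ∀ m ≤ N, ∃ a', R ((List.range m).foldl
        (fun A j => (loops xs c).run N (Function.update η x j) A) A) a' ∧
        (μ a' < μ a ∨ a' = a ∧ ∀ i < m, ∀ ζ ∈ Box N xs (Function.update η x i), Q ζ a) := by
      intro m hm
      induction m with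
      | zero => exact ⟨a, hA, by simp⟩
      | succ m ihm =>
        obtain ⟨a₁, hR, h₁⟩ := ihm (by omega)
        obtain ⟨a₂, hR', h₂⟩ := ih (η := Function.update η x m)
          (fun ζ hζ => h ζ (mem_box_cons.2 ⟨m, hm, hζ⟩)) hR
        rw [List.range_succ, List.foldl_append, List.foldl_cons, List.foldl_nil]
        refine ⟨a₂, hR', ?_⟩
        rcases h₁ with h₁ | ⟨rfl, h₁⟩
        · rcases h₂ with h₂ | ⟨rfl, h₂⟩
          exacts [Or.inl (h₂.trans h₁), Or.inl h₁]
        · rcases h₂ with h₂ | ⟨rfl, h₂⟩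
          · exact Or.inl h₂
          · refine Or.inr ⟨rfl, fun i hi => ?_⟩
            rcases Nat.lt_succ_iff_lt_or_eq.1 hi with hi | rfl
            exacts [h₁ i hi, h₂]
    obtain ⟨a', hR, h'⟩ := key N le_rfl
    refine ⟨a', hR, h'.imp id fun h' => ⟨h'.1, fun ζ hζ => ?_⟩⟩
    obtain ⟨i, hi, hζ⟩ := mem_box_cons.1 hζ
    exact h'.2 i hi ζ hζ

/-- Repeating `N` times a command that decreases a measure until it is at most `b`. -/
theorem run_loop_measure {α : Type*} (R : Store → α → Prop) (μ : α → ℕ) {x : Name} {c : Cmd}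
    {η : Env} (b : ℕ)
    (h : ∀ i < N, ∀ A a, R A a →
      ∃ a', R (c.run N (Function.update η x i) A) a' ∧ (μ a' < μ a ∨ a' = a ∧ μ a ≤ b))
    {A : Store} {a : α} (hA : R A a) :
    ∃ a', R ((Cmd.loop x c).run N η A) a' ∧ (μ a' ≤ b ∨ μ a' + N ≤ μ a) := by
  have key : ∀ m ≤ N, ∃ a', R ((List.range m).foldl
      (fun A j => c.run N (Function.update η x j) A) A) a' ∧ (μ a' ≤ b ∨ μ a' + m ≤ μ a) := by
    intro m hm
    induction m with
    | zero => exact ⟨a, hA, by simp⟩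
    | succ m ihm =>
      obtain ⟨a₁, hR, h₁⟩ := ihm (by omega)
      obtain ⟨a₂, hR', h₂⟩ := h m hm _ _ hR
      rw [List.range_succ, List.foldl_append, List.foldl_cons, List.foldl_nil]
      refine ⟨a₂, hR', ?_⟩
      rcases h₂ with h₂ | ⟨rfl, h₂⟩ <;> omega
  exact key N le_rfl

end Cmd

/-! ### Small modules in modular decomposition trees -/

namespace ModularTree

variable {V : Type*}

theorem Adj.mem_leaves {T : ModularTree V} {u v : V} (h : T.Adj u v) :
    u ∈ T.leaves ∧ v ∈ T.leaves := by
  induction T with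
  | leaf w => exact h.elim
  | union m child ih =>
    obtain ⟨i, hi⟩ := h
    simp only [leaves, List.mem_flatten, List.mem_ofFn, exists_exists_eq_and]
    exact ⟨⟨i, (ih i hi).1⟩, ⟨i, (ih i hi).2⟩⟩
  | join m child ih | prime m H child ih =>
    simp only [leaves, List.mem_flatten, List.mem_ofFn, exists_exists_eq_and]
    obtain ⟨i, hi⟩ | ⟨i, j, -, hi, hj⟩ := h
    · exact ⟨⟨i, (ih i hi).1⟩, ⟨i, (ih i hi).2⟩⟩
    · exact ⟨⟨i, hi⟩, ⟨j, hj⟩⟩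

/-- The inductive step of `exists_module`: the node of a tree whose children are joined to each
other according to the relation `r`. Either two elements of `A` belong to the same child, and the
module is found there, or the elements of `A` belong to different children. In the latter case `A`
itself is small, or `r` is constant and any two elements of `A` are twins. -/
theorem exists_module_of_children {m k : ℕ} {child : Fin m → ModularTree V}
    {r : Fin m → Fin m → Prop} {adj : V → V → Prop}
    (hadj : ∀ u v, adj u v ↔ (∃ i, (child i).Adj u v) ∨
      ∃ i j, r i j ∧ u ∈ (child i).leaves ∧ v ∈ (child j).leaves)
    (hnd : (List.ofFn fun i => (child i).leaves).flatten.Nodup)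
    (ih : ∀ i, (child i).leaves.Nodup → ∀ A : Finset V, (∀ v ∈ A, v ∈ (child i).leaves) →
      2 ≤ A.card → ∃ M ⊆ A, 2 ≤ M.card ∧ M.card ≤ k + 2 ∧
        ∀ u ∈ A, u ∉ M → ∀ x ∈ M, ∀ y ∈ M, ((child i).Adj u x ↔ (child i).Adj u y))
    (hr : m ≤ k ∨ ∃ p, ∀ i j, i ≠ j → (r i j ↔ p))
    {A : Finset V} (hA : ∀ v ∈ A, v ∈ (List.ofFn fun i => (child i).leaves).flatten)
    (hcard : 2 ≤ A.card) :
    ∃ M ⊆ A, 2 ≤ M.card ∧ M.card ≤ k + 2 ∧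
      ∀ u ∈ A, u ∉ M → ∀ x ∈ M, ∀ y ∈ M, (adj u x ↔ adj u y) := by
  classical
  rw [List.nodup_flatten] at hnd
  obtain ⟨hnd, hdisj⟩ := hnd
  have hnd : ∀ i, (child i).leaves.Nodup := fun i => hnd _ (by simp)
  rw [List.pairwise_ofFn] at hdisj
  have huniq : ∀ {i j v}, v ∈ (child i).leaves → v ∈ (child j).leaves → i = j := by
    intro i j v hi hj
    rcases lt_trichotomy i j with h | h | h
    exacts [(hdisj h hi hj).elim, h, (hdisj h hj hi).elim]
  simp only [List.mem_flatten, List.mem_ofFn, exists_exists_eq_and] at hA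
  by_cases hbig : ∃ i, 2 ≤ (A.filter (· ∈ (child i).leaves)).card
  · obtain ⟨i, hi⟩ := hbig
    obtain ⟨M, hMA, h2, hk, hM⟩ := ih i (hnd i) _ (fun v hv => (Finset.mem_filter.1 hv).2) hi
    refine ⟨M, hMA.trans (Finset.filter_subset _ _), h2, hk, fun u hu huM x hx y hy => ?_⟩
    have hx' := (Finset.mem_filter.1 (hMA hx)).2
    have hy' := (Finset.mem_filter.1 (hMA hy)).2
    have h₁ : ∀ {z}, z ∈ (child i).leaves →
        ((∃ j, (child j).Adj u z) ↔ (child i).Adj u z) := by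
      intro z hz
      refine ⟨?_, fun h => ⟨i, h⟩⟩
      rintro ⟨j, hj⟩
      obtain rfl := huniq hz hj.mem_leaves.2
      exact hj
    have h₂ : ∀ {z}, z ∈ (child i).leaves →
        ((∃ j l, r j l ∧ u ∈ (child j).leaves ∧ z ∈ (child l).leaves) ↔
          ∃ j, r j i ∧ u ∈ (child j).leaves) := by
      intro z hz
      constructor
      · rintro ⟨j, l, hr, hj, hl⟩
        obtain rfl := huniq hz hl
        exact ⟨j, hr, hj⟩
      · rintro ⟨j, hr, hj⟩
        exact ⟨j, i, hr, hj, hz⟩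
    rw [hadj, hadj, h₁ hx', h₁ hy', h₂ hx', h₂ hy']
    refine or_congr_left ?_
    by_cases hui : u ∈ (child i).leaves
    · exact hM u (Finset.mem_filter.2 ⟨hu, hui⟩) huM x hx y hy
    · exact ⟨fun h => (hui h.mem_leaves.1).elim, fun h => (hui h.mem_leaves.1).elim⟩
  · push Not at hbig
    have hsep : ∀ {i u v}, u ∈ A → v ∈ A → u ∈ (child i).leaves → v ∈ (child i).leaves →
        u = v := by
      intro i u v hu hv hui hvi
      have := Nat.lt_succ_iff.1 (hbig i)
      exact Finset.card_le_one.1 this u (by simp [hu, hui]) v (by simp [hv, hvi])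
    rcases hr with hm | ⟨p, hp⟩
    · refine ⟨A, subset_rfl, hcard, ?_, fun u hu hu' => (hu' hu).elim⟩
      choose g hg using hA
      have : Fintype.card A ≤ Fintype.card (Fin m) :=
        Fintype.card_le_of_injective (fun u : A => g u u.2) fun u v huv =>
          Subtype.ext (hsep u.2 v.2 (hg u u.2) (by
            have : g u u.2 = g v v.2 := huv
            exact this ▸ hg v v.2))
      simp only [Fintype.card_coe, Fintype.card_fin] at this
      omega
    · obtain ⟨M, hMA, hM⟩ := Finset.exists_subset_card_eq hcard
      refine ⟨M, hMA, hM.ge, by omega, fun u hu huM x hx y hy => ?_⟩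
      have key : ∀ {z}, z ∈ M → (adj u z ↔ p) := by
        intro z hz
        obtain ⟨i, hi⟩ := hA u hu
        obtain ⟨j, hj⟩ := hA z (hMA hz)
        have hij : i ≠ j := by
          rintro rfl
          exact huM (hsep hu (hMA hz) hi hj ▸ hz)
        rw [hadj]
        constructor
        · rintro (⟨l, hl⟩ | ⟨i', j', h, hi', hj'⟩)
          · obtain ⟨h₁, h₂⟩ := hl.mem_leaves
            exact (hij ((huniq hi h₁).trans (huniq hj h₂).symm)).elim
          · obtain rfl := huniq hi hi'
            obtain rfl := huniq hj hj'
            exact (hp _ _ hij).1 h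
        · exact fun h => Or.inr ⟨i, j, (hp _ _ hij).2 h, hi, hj⟩
      rw [key hx, key hy]

/-- In the graph induced on any set of at least two leaves, there is a module of bounded size with
at least two elements. -/
theorem exists_module {k : ℕ} {T : ModularTree V} (hnd : T.leaves.Nodup)
    (hT : T.PrimeNodesAtMost k) {A : Finset V} (hA : ∀ v ∈ A, v ∈ T.leaves) (hcard : 2 ≤ A.card) :
    ∃ M ⊆ A, 2 ≤ M.card ∧ M.card ≤ k + 2 ∧
      ∀ u ∈ A, u ∉ M → ∀ x ∈ M, ∀ y ∈ M, (T.Adj u x ↔ T.Adj u y) := by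
  induction T generalizing A with
  | leaf v =>
    have : A ⊆ {v} := fun u hu => by simpa [leaves] using hA u hu
    have := Finset.card_le_card this
    simp only [Finset.card_singleton] at this
    omega
  | union m child ih =>
    exact exists_module_of_children (r := fun _ _ => False) (fun u v => by simp [Adj]) hnd
      (fun i hi A hA hc => ih i hi (hT i) hA hc) (Or.inr ⟨False, fun _ _ _ => Iff.rfl⟩) hA hcard
  | join m child ih =>
    exact exists_module_of_children (r := fun i j => i ≠ j) (fun u v => Iff.rfl) hnd
      (fun i hi A hA hc => ih i hi (hT i) hA hc) (Or.inr ⟨True, fun _ _ h => by simpa using h⟩)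
      hA hcard
  | prime m H child ih =>
    exact exists_module_of_children (r := H.Adj) (fun u v => Iff.rfl) hnd
      (fun i hi A hA hc => ih i hi (hT.2 i) hA hc) (Or.inl hT.1) hA hcard

end ModularTree

/-! ### Clique packings and profiles -/

namespace SimpleGraph

variable {V : Type} [DecidableEq V] {G : SimpleGraph V}

/-- There are pairwise disjoint cliques in `B` that have the sizes `κ a`. -/
def Packable (G : SimpleGraph V) (B : Finset V) {ι : Type} (κ : ι → ℕ) : Prop :=
  ∃ D : ι → Finset V, (∀ a, D a ⊆ B ∧ G.IsNClique (κ a) (D a)) ∧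
    ∀ a b, a ≠ b → Disjoint (D a) (D b)

omit [DecidableEq V] in
/-- Whether cliques can be packed depends only on the number of cliques of each positive size. -/
theorem Packable.of_card_le {B : Finset V} {ι ι' : Type} [Fintype ι] [Fintype ι'] {κ : ι → ℕ}
    {κ' : ι' → ℕ} (h : ∀ j, j ≠ 0 → (Finset.univ.filter fun a => κ' a = j).card ≤
      (Finset.univ.filter fun a => κ a = j).card)
    (hB : G.Packable B κ) : G.Packable B κ' := by
  classical
  obtain ⟨D, hD, hdisj⟩ := hB
  have hemb : ∀ j, j ≠ 0 → Nonempty ({a // κ' a = j} ↪ {a // κ a = j}) := fun j hj =>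
    Function.Embedding.nonempty_of_card_le (by simpa [Fintype.card_subtype] using h j hj)
  have g := fun j hj => (hemb j hj).some
  refine ⟨fun a => if h : κ' a = 0 then ∅ else D (g _ h ⟨a, rfl⟩), fun a => ?_, fun a b hab => ?_⟩
  · dsimp only
    split_ifs with h
    · simp [h, isNClique_iff]
    · refine ⟨(hD _).1, ?_⟩
      have := (hD (g _ h ⟨a, rfl⟩ : {b // κ b = κ' a})).2
      rwa [(g _ h ⟨a, rfl⟩).2] at this
  · dsimp only
    by_cases h : κ' a = 0
    · simp [h]
    by_cases h' : κ' b = 0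
    · simp [h']
    · rw [dif_neg h, dif_neg h']
      refine hdisj _ _ fun heq => hab ?_
      have hκ : κ' a = κ' b := by
        rw [← (g _ h ⟨a, rfl⟩).2, heq, (g _ h' ⟨b, rfl⟩).2]
      have key : ∀ (j : ℕ) (hj : j ≠ 0) (hb : κ' b = j),
          (g _ h' ⟨b, rfl⟩ : ι) = g j hj ⟨b, hb⟩ := by
        rintro _ _ rfl
        rfl
      rw [key _ h hκ.symm] at heq
      exact congrArg Subtype.val ((g _ h).injective (Subtype.ext heq))

/-- Cliques in a union of homogeneous blocks consist of cliques in the blocks. Here `r` tells which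
blocks are joined to each other, and `φ a i` is the size of the trace of clique `a` in block `i`. -/
theorem packable_biUnion {K : ℕ} {B : Fin K → Finset V} {r : Fin K → Fin K → Prop}
    (hB : ∀ i j, i ≠ j → Disjoint (B i) (B j))
    (hr : ∀ i j, i ≠ j → ∀ x ∈ B i, ∀ y ∈ B j, (G.Adj x y ↔ r i j)) {ι : Type} {κ : ι → ℕ} :
    G.Packable (Finset.univ.biUnion B) κ ↔ ∃ φ : ι → Fin K → ℕ, (∀ a, ∑ i, φ a i = κ a) ∧
      (∀ a i j, i ≠ j → φ a i ≠ 0 → φ a j ≠ 0 → r i j) ∧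
        ∀ i, G.Packable (B i) fun a => φ a i := by
  constructor
  · rintro ⟨D, hD, hdisj⟩
    refine ⟨fun a i => (D a ∩ B i).card, fun a => ?_, fun a i j hij hi hj => ?_, fun i =>
      ⟨fun a => D a ∩ B i, fun a => ⟨Finset.inter_subset_right, ?_⟩, fun a b hab => ?_⟩⟩
    · rw [← Finset.card_biUnion, ← (hD a).2.card_eq]
      · congr 1
        ext v
        have : v ∈ D a → ∃ i, v ∈ B i := fun hv => by simpa using (hD a).1 hv
        simpa using this
      · exact fun i _ j _ hij => (hB i j hij).mono Finset.inter_subset_right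
          Finset.inter_subset_right
    · obtain ⟨x, hx⟩ := Finset.card_ne_zero.1 hi
      obtain ⟨y, hy⟩ := Finset.card_ne_zero.1 hj
      rw [Finset.mem_inter] at hx hy
      refine (hr i j hij x hx.2 y hy.2).1 ((hD a).2.isClique hx.1 hy.1 ?_)
      rintro rfl
      exact Finset.disjoint_left.1 (hB i j hij) hx.2 hy.2
    · exact ⟨(hD a).2.isClique.subset (by simp), rfl⟩
    · exact (hdisj a b hab).mono Finset.inter_subset_left Finset.inter_subset_left
  · rintro ⟨φ, hφ, hφr, h⟩
    choose D hD hdisj using h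
    have hDB : ∀ i j a b, i ≠ j → Disjoint (D i a) (D j b) := fun i j a b hij =>
      (hB i j hij).mono (hD i a).1 (hD j b).1
    refine ⟨fun a => Finset.univ.biUnion fun i => D i a, fun a => ⟨?_, ?_, ?_⟩, fun a b hab => ?_⟩
    · exact Finset.biUnion_mono fun i _ => (hD i a).1
    · intro x hx y hy hxy
      simp only [Finset.coe_biUnion, Finset.coe_univ, Set.mem_univ, Set.iUnion_true,
        Set.mem_iUnion, Finset.mem_coe] at hx hy
      obtain ⟨i, hi⟩ := hx
      obtain ⟨j, hj⟩ := hy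
      by_cases hij : i = j
      · subst hij
        exact (hD i a).2.isClique hi hj hxy
      · refine (hr i j hij x ((hD i a).1 hi) y ((hD j a).1 hj)).2 (hφr a i j hij ?_ ?_)
        · exact (hD i a).2.card_eq.symm.trans_ne (Finset.card_ne_zero.2 ⟨x, hi⟩)
        · exact (hD j a).2.card_eq.symm.trans_ne (Finset.card_ne_zero.2 ⟨y, hj⟩)
    · rw [Finset.card_biUnion fun i _ j _ hij => hDB i j a a hij, ← hφ]
      exact Finset.sum_congr rfl fun i _ => (hD i a).2.card_eq
    · simp only [Finset.disjoint_biUnion_left, Finset.disjoint_biUnion_right]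
      intro i _ j _
      by_cases hij : i = j
      · subst hij
        exact hdisj _ a b hab
      · exact hDB _ _ a b (Ne.symm hij)

/-- The profile of `B`: the triples `c` such that `B` contains pairwise disjoint cliques, `c j` of
which have size `j + 1`. -/
def Prof (G : SimpleGraph V) (B : Finset V) (c : Fin 3 → ℕ) : Prop :=
  G.Packable B fun a : (j : Fin 3) × Fin (c j) => (a.1 : ℕ) + 1

theorem card_filter_comp {ι τ : Type} [Fintype ι] [Fintype τ] [DecidableEq τ] (g : ι → τ)
    (p : τ → Prop) [DecidablePred p] :
    (Finset.univ.filter fun a => p (g a)).card =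
      ∑ f, if p f then (Finset.univ.filter fun a => g a = f).card else 0 := by
  rw [← Finset.sum_filter, Finset.card_eq_sum_card_fiberwise (t := Finset.univ.filter p) (f := g)]
  · refine Finset.sum_congr rfl fun f hf => ?_
    congr 1
    ext a
    simp only [Finset.mem_filter, Finset.mem_univ, true_and] at hf ⊢
    exact ⟨fun h => h.2, fun h => ⟨h ▸ hf, h⟩⟩
  · intro a ha
    simpa using ha

theorem card_filter_sigma_fst {τ : Type} [Fintype τ] [DecidableEq τ] (x : τ → ℕ) (p : τ → Prop)
    [DecidablePred p] : (Finset.univ.filter fun a : (f : τ) × Fin (x f) => p a.1).card =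
      ∑ f, if p f then x f else 0 := by
  rw [card_filter_comp Sigma.fst p]
  refine Finset.sum_congr rfl fun f _ => ?_
  congr 1
  rw [← Fintype.card_subtype, Fintype.card_congr (Equiv.sigmaSubtype f), Fintype.card_fin]

omit [DecidableEq V] in
theorem packable_iff_prof {B : Finset V} {ι : Type} [Fintype ι] {κ : ι → ℕ} (hκ : ∀ a, κ a ≤ 3)
    {c : Fin 3 → ℕ} (hc : ∀ j : Fin 3, c j = (Finset.univ.filter fun a => κ a = j + 1).card) :
    G.Packable B κ ↔ G.Prof B c := by
  have h : ∀ j, j ≠ 0 → (Finset.univ.filter fun a => κ a = j).card = (Finset.univ.filter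
      fun a : (j : Fin 3) × Fin (c j) => (a.1 : ℕ) + 1 = j).card := by
    intro j hj
    rw [card_filter_sigma_fst c fun i : Fin 3 => (i : ℕ) + 1 = j]
    by_cases hj3 : j ≤ 3
    · have hi : ∀ i : Fin 3, (i : ℕ) + 1 = j ↔ i = ⟨j - 1, by omega⟩ := by
        intro i
        rw [Fin.ext_iff]
        simp only
        omega
      simp only [hi, Finset.sum_ite_eq', Finset.mem_univ, if_true, hc]
      rw [Nat.sub_add_cancel (by omega)]
    · rw [Finset.sum_eq_zero fun i _ => if_neg (by omega), Finset.card_eq_zero,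
        Finset.filter_eq_empty_iff]
      intro a _ ha
      exact hj3 (ha ▸ hκ a)
  exact ⟨Packable.of_card_le fun j hj => (h j hj).ge, Packable.of_card_le fun j hj => (h j hj).le⟩

theorem Packable.card_le {B : Finset V} {ι : Type} [Fintype ι] {κ : ι → ℕ} (hκ : ∀ a, κ a ≠ 0)
    (h : G.Packable B κ) : Fintype.card ι ≤ B.card := by
  obtain ⟨D, hD, hdisj⟩ := h
  have h₁ : (Finset.univ.biUnion D).card = ∑ a, (D a).card :=
    Finset.card_biUnion fun a _ b _ hab => hdisj a b hab
  have h₂ : (Finset.univ.biUnion D).card ≤ B.card :=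
    Finset.card_le_card (Finset.biUnion_subset.2 fun a _ => (hD a).1)
  have h₃ : ∑ _a : ι, 1 ≤ ∑ a, (D a).card := Finset.sum_le_sum fun a _ => by
    rw [(hD a).2.card_eq]
    exact Nat.one_le_iff_ne_zero.2 (hκ a)
  simp only [Finset.sum_const, Finset.card_univ, smul_eq_mul, mul_one] at h₃
  omega

theorem Prof.le_card {B : Finset V} {c : Fin 3 → ℕ} (h : G.Prof B c) (j : Fin 3) :
    c j ≤ B.card := by
  have := Packable.card_le (by simp) h
  rw [Fintype.card_sigma] at this
  simp only [Fintype.card_fin] at this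
  exact (Finset.single_le_sum (fun _ _ => Nat.zero_le _) (Finset.mem_univ j)).trans this

/-- The profile of a union of homogeneous blocks is determined by the profiles of the blocks. The
cliques in the union are counted by type, where the type of a clique is the function that gives the
sizes of its traces in the blocks, and `x f` is the number of cliques of type `f`. -/
theorem prof_biUnion {K N : ℕ} {B : Fin K → Finset V} {r : Fin K → Fin K → Prop}
    (hB : ∀ i j, i ≠ j → Disjoint (B i) (B j))
    (hr : ∀ i j, i ≠ j → ∀ x ∈ B i, ∀ y ∈ B j, (G.Adj x y ↔ r i j))
    (hN : (Finset.univ.biUnion B).card < N) {c : Fin 3 → ℕ} :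
    G.Prof (Finset.univ.biUnion B) c ↔ ∃ x : (Fin K → Fin 4) → ℕ, (∀ f, x f < N) ∧
      (∀ f, x f ≠ 0 → ∑ i, (f i : ℕ) ≤ 3 ∧ ∀ i j, i ≠ j → f i ≠ 0 → f j ≠ 0 → r i j) ∧
      (∀ i, G.Prof (B i) fun j => ∑ f : Fin K → Fin 4, if f i = j.succ then x f else 0) ∧
      ∀ j : Fin 3, c j = ∑ f : Fin K → Fin 4, if ∑ i, (f i : ℕ) = j + 1 then x f else 0 := by
  constructor
  · intro h
    have hcard := Packable.card_le (by simp) h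
    obtain ⟨φ, hφ, hφr, hφB⟩ := (packable_biUnion hB hr).1 h
    have hφ3 : ∀ a i, φ a i ≤ 3 := by
      intro a i
      have h₁ : φ a i ≤ ∑ i, φ a i :=
        Finset.single_le_sum (fun _ _ => Nat.zero_le _) (Finset.mem_univ i)
      have := a.1.2
      rw [hφ a] at h₁
      omega
    let g : ((j : Fin 3) × Fin (c j)) → Fin K → Fin 4 := fun a i =>
      ⟨φ a i, Nat.lt_succ_of_le (hφ3 a i)⟩
    refine ⟨fun f => (Finset.univ.filter fun a => g a = f).card, fun f => ?_, fun f hf => ?_,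
      fun i => ?_, fun j => ?_⟩
    · exact ((Finset.card_le_univ _).trans hcard).trans_lt hN
    · obtain ⟨a, ha⟩ := Finset.card_ne_zero.1 hf
      obtain rfl : g a = f := by simpa using ha
      refine ⟨?_, fun i j hij hi hj => hφr a i j hij ?_ ?_⟩
      · have := a.1.2
        simp only [g, hφ a]
        omega
      · simpa [g, Fin.ext_iff] using hi
      · simpa [g, Fin.ext_iff] using hj
    · refine (packable_iff_prof (fun a => hφ3 a i) fun j => ?_).1 (hφB i)
      dsimp only
      rw [← card_filter_comp g fun f => f i = j.succ]
      congr 1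
      ext a
      simp [g, Fin.ext_iff]
    · dsimp only
      rw [← card_filter_comp g fun f => ∑ i, (f i : ℕ) = j + 1]
      simp only [g, hφ, Nat.add_right_cancel_iff]
      rw [card_filter_sigma_fst c fun i : Fin 3 => (i : ℕ) = j]
      simp [← Fin.ext_iff]
  · rintro ⟨x, -, hx, hxB, hc⟩
    have hx' : ∀ a : (f : Fin K → Fin 4) × Fin (x f), x a.1 ≠ 0 := fun a => by
      have := a.2.2
      omega
    refine (packable_iff_prof (ι := (f : Fin K → Fin 4) × Fin (x f))
      (κ := fun a => ∑ i, (a.1 i : ℕ)) (fun a => (hx _ (hx' a)).1) fun j => ?_).1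
      ((packable_biUnion hB hr).2 ⟨fun a i => a.1 i, fun a => rfl, fun a i j hij hi hj => ?_,
        fun i => ?_⟩)
    · rw [hc, card_filter_sigma_fst x fun f => ∑ i, (f i : ℕ) = j + 1]
    · exact (hx _ (hx' a)).2 i j hij (fun h => hi (by simp [h]))
        (fun h => hj (by simp [h]))
    · refine (packable_iff_prof (fun a => Nat.le_of_lt_succ (a.1 i).2) fun j => ?_).2 (hxB i)
      rw [← card_filter_sigma_fst x fun f => f i = j.succ]
      congr 1
      ext a
      simp [Fin.ext_iff]

theorem prof_empty {c : Fin 3 → ℕ} : G.Prof ∅ c ↔ ∀ j, c j = 0 := by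
  constructor
  · exact fun h j => Nat.le_zero.1 (h.le_card j)
  · intro h
    have : IsEmpty ((j : Fin 3) × Fin (c j)) := ⟨fun a => by
      have := a.2.2
      have := h a.1
      omega⟩
    exact ⟨isEmptyElim, isEmptyElim, isEmptyElim⟩

theorem prof_singleton {v : V} {c : Fin 3 → ℕ} :
    G.Prof {v} c ↔ c 0 ≤ 1 ∧ c 1 = 0 ∧ c 2 = 0 := by
  constructor
  · intro h
    have hle : ∀ j : Fin 3, c j ≠ 0 → (j : ℕ) + 1 ≤ 1 := fun j hj => by
      obtain ⟨D, hD, -⟩ := h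
      have h₁ := (hD ⟨j, ⟨0, Nat.pos_of_ne_zero hj⟩⟩)
      have h₂ := Finset.card_le_card h₁.1
      rw [h₁.2.card_eq, Finset.card_singleton] at h₂
      exact h₂
    refine ⟨by simpa using h.le_card 0, ?_, ?_⟩
    · by_contra h1
      exact absurd (hle 1 h1) (by decide)
    · by_contra h2
      exact absurd (hle 2 h2) (by decide)
  · rintro ⟨h0, h1, h2⟩
    have hsub : ∀ a : (j : Fin 3) × Fin (c j), a.1 = 0 := by
      rintro ⟨j, i⟩
      have := i.2
      fin_cases j
      · rfl
      · simp only [Fin.mk_one, h1] at this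
        omega
      · simp only [Fin.reduceFinMk, h2] at this
        omega
    refine ⟨fun _ => {v}, fun a => ⟨subset_rfl, ?_⟩, fun a b hab => (hab ?_).elim⟩
    · simp [hsub a, isNClique_iff]
    · obtain ⟨i, a⟩ := a
      obtain ⟨j, b⟩ := b
      obtain rfl : i = 0 := hsub ⟨i, a⟩
      obtain rfl : j = 0 := hsub ⟨j, b⟩
      have := a.2
      have := b.2
      congr 1
      exact Fin.ext (by omega)

end SimpleGraph

/-! ### The packing number -/

namespace SimpleGraph

variable {V : Type} [DecidableEq V] {G : SimpleGraph V}

theorem prof_triangles_iff {S : Finset V} {m : ℕ} : G.Prof S ![0, 0, m] ↔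
    ∃ Q : Finset (Finset V), G.IsTrianglePacking Q ∧ (∀ T ∈ Q, T ⊆ S) ∧ Q.card = m := by
  have hcard : ∀ Q : Finset (Finset V), Q.card = m → (G.Packable S (fun _ : Q => 3) ↔
      G.Prof S ![0, 0, m]) := by
    intro Q hQ
    refine packable_iff_prof (fun _ => le_rfl) fun j => ?_
    fin_cases j
    · simp
    · simp
    · simp [hQ]
  constructor
  · intro h
    have h' : G.Packable S fun _ : Fin m => 3 := by
      refine (packable_iff_prof (fun _ => le_rfl) fun j => ?_).2 h
      fin_cases j <;> simp
    obtain ⟨D, hD, hdisj⟩ := h'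
    have hinj : Function.Injective D := by
      intro a b hab
      by_contra hne
      have h₁ := hdisj a b hne
      rw [hab, disjoint_self, Finset.bot_eq_empty] at h₁
      have h₂ := (hD b).2.card_eq
      simp [h₁] at h₂
    refine ⟨Finset.univ.image D, ⟨?_, ?_⟩, ?_, ?_⟩
    · simp only [Finset.mem_image, Finset.mem_univ, true_and]
      rintro _ ⟨a, rfl⟩
      exact (hD a).2
    · simp only [Finset.mem_image, Finset.mem_univ, true_and]
      rintro _ ⟨a, rfl⟩ _ ⟨b, rfl⟩ hab
      exact hdisj a b fun h => hab (congrArg D h)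
    · simp only [Finset.mem_image, Finset.mem_univ, true_and]
      rintro _ ⟨a, rfl⟩
      exact (hD a).1
    · rw [Finset.card_image_of_injective _ hinj, Finset.card_univ, Fintype.card_fin]
  · rintro ⟨Q, hQ, hQS, hm⟩
    exact (hcard Q hm).1 ⟨fun T => T.1, fun T => ⟨hQS _ T.2, hQ.isTriangle _ T.2⟩, fun T T' h =>
      hQ.disjoint _ T.2 _ T'.2 fun h' => h (Subtype.ext h')⟩

open Classical in
/-- The largest number of pairwise disjoint triangles in `S`. -/
noncomputable def packNum (G : SimpleGraph V) (S : Finset V) : ℕ :=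
  Nat.findGreatest (fun m => G.Prof S ![0, 0, m]) S.card

omit [DecidableEq V] in
theorem packNum_le_card (G : SimpleGraph V) (S : Finset V) : G.packNum S ≤ S.card := by
  classical
  exact Nat.findGreatest_le _

theorem exists_card_eq_packNum (G : SimpleGraph V) (S : Finset V) : ∃ Q : Finset (Finset V),
    G.IsTrianglePacking Q ∧ (∀ T ∈ Q, T ⊆ S) ∧ Q.card = G.packNum S := by
  classical
  refine prof_triangles_iff.1 (Nat.findGreatest_spec (P := fun m => G.Prof S ![0, 0, m])
    (Nat.zero_le _) (prof_triangles_iff.2 ⟨∅, ⟨by simp, by simp⟩, by simp, rfl⟩))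

theorem IsTrianglePacking.card_le_packNum {S : Finset V} {Q : Finset (Finset V)}
    (hQ : G.IsTrianglePacking Q) (hQS : ∀ T ∈ Q, T ⊆ S) : Q.card ≤ G.packNum S := by
  classical
  have h := prof_triangles_iff.2 ⟨Q, hQ, hQS, rfl⟩
  exact Nat.le_findGreatest (P := fun m => G.Prof S ![0, 0, m]) (by simpa using h.le_card 2) h

theorem prof_triangles_iff_le {S : Finset V} {m : ℕ} :
    G.Prof S ![0, 0, m] ↔ m ≤ G.packNum S := by
  constructor
  · intro h
    obtain ⟨Q, hQ, hQS, rfl⟩ := prof_triangles_iff.1 h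
    exact hQ.card_le_packNum hQS
  · intro h
    obtain ⟨Q, hQ, hQS, hm⟩ := G.exists_card_eq_packNum S
    obtain ⟨Q', hQ', rfl⟩ := Finset.exists_subset_card_eq (hm.symm ▸ h)
    exact prof_triangles_iff.2 ⟨Q', ⟨fun T hT => hQ.isTriangle T (hQ' hT), fun T hT T' hT' =>
      hQ.disjoint T (hQ' hT) T' (hQ' hT')⟩, fun T hT => hQS T (hQ' hT), rfl⟩

theorem IsTrianglePacking.insert {P : Finset (Finset V)} (hP : G.IsTrianglePacking P)
    {T : Finset V} (hT : G.IsNClique 3 T) (hd : ∀ T' ∈ P, Disjoint T' T) :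
    G.IsTrianglePacking (insert T P) ∧ T ∉ P := by
  refine ⟨⟨fun T' hT' => ?_, fun T₁ m₁ T₂ m₂ hne => ?_⟩, fun h => ?_⟩
  · rcases Finset.mem_insert.1 hT' with rfl | h
    exacts [hT, hP.isTriangle _ h]
  · rcases Finset.mem_insert.1 m₁ with rfl | h₁ <;> rcases Finset.mem_insert.1 m₂ with rfl | h₂
    exacts [(hne rfl).elim, (hd _ h₂).symm, hd _ h₁, hP.disjoint _ h₁ _ h₂ hne]
  · have h₁ := hd T h
    rw [disjoint_self, Finset.bot_eq_empty] at h₁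
    have h₂ := hT.card_eq
    simp [h₁] at h₂

/-- Some triangle can be removed such that the packing number drops by one only: any member of a
maximum packing. -/
theorem exists_triangle_packNum {S : Finset V} (h : G.packNum S ≠ 0) :
    ∃ T ⊆ S, G.IsNClique 3 T ∧ G.packNum (S \ T) + 1 = G.packNum S := by
  obtain ⟨Q, hQ, hQS, hcard⟩ := G.exists_card_eq_packNum S
  obtain ⟨T, hT⟩ := Finset.card_ne_zero.1 (hcard.trans_ne h)
  refine ⟨T, hQS T hT, hQ.isTriangle T hT, le_antisymm ?_ ?_⟩
  · obtain ⟨Q', hQ', hQS', hcard'⟩ := G.exists_card_eq_packNum (S \ T)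
    obtain ⟨hins, hnot⟩ := hQ'.insert (hQ.isTriangle T hT) fun T' hT' =>
      Finset.disjoint_of_subset_left (hQS' T' hT') Finset.sdiff_disjoint
    rw [← hcard', ← Finset.card_insert_of_notMem hnot]
    refine hins.card_le_packNum fun T' hT' => ?_
    rcases Finset.mem_insert.1 hT' with rfl | h
    exacts [hQS _ hT, (hQS' T' h).trans Finset.sdiff_subset]
  · have : (Q.erase T).card ≤ G.packNum (S \ T) := by
      refine IsTrianglePacking.card_le_packNum ⟨fun T' hT' => hQ.isTriangle T'
        (Finset.mem_of_mem_erase hT'), fun T₁ h₁ T₂ h₂ => hQ.disjoint T₁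
        (Finset.mem_of_mem_erase h₁) T₂ (Finset.mem_of_mem_erase h₂)⟩ fun T' hT' => ?_
      rw [Finset.mem_erase] at hT'
      exact Finset.subset_sdiff.2 ⟨hQS T' hT'.2, hQ.disjoint T' hT'.2 T hT hT'.1⟩
    rw [Finset.card_erase_of_mem hT, hcard] at this
    omega

end SimpleGraph

/-! ### Contraction of modules -/

/-- `B` is a partition of the vertex set `S` into blocks, indexed by representatives, such that
adjacency of vertices of different blocks is adjacency of the representatives. The block of a
number that is not a representative is empty. -/
structure BlockPartition (Γ : SimpleGraph ℕ) (S : Finset ℕ) (B : ℕ → Finset ℕ) : Prop where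
  disjoint : ∀ u v, u ≠ v → Disjoint (B u) (B v)
  mem_self : ∀ u, (B u).Nonempty → u ∈ B u
  mem_iff : ∀ x, x ∈ S ↔ ∃ u, x ∈ B u
  adj_iff : ∀ u v, u ≠ v → ∀ x ∈ B u, ∀ y ∈ B v, (Γ.Adj x y ↔ Γ.Adj u v)

/-- The blocks after the blocks of `w 0, w 1, …` have been merged into one, with representative
`w 0`. -/
def contract {K : ℕ} (w : Fin (K + 2) → ℕ) (B : ℕ → Finset ℕ) (u : ℕ) : Finset ℕ :=
  if u = w 0 then Finset.univ.biUnion fun i => B (w i) else if ∃ i, w i = u then ∅ else B u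

/-- The representatives among `w 0, w 1, …` are distinct and form a module of the graph on all
representatives; `w 0` and `w 1` are representatives. -/
structure IsModuleTuple {K : ℕ} (Γ : SimpleGraph ℕ) (B : ℕ → Finset ℕ) (w : Fin (K + 2) → ℕ) :
    Prop where
  nonempty_zero : (B (w 0)).Nonempty
  nonempty_one : (B (w 1)).Nonempty
  eq_empty : ∀ i j, i ≠ j → w i = w j → ¬ (B (w i)).Nonempty
  adj_iff : ∀ u, (B u).Nonempty → (∀ i, w i ≠ u) → ∀ i j, (B (w i)).Nonempty →
    (B (w j)).Nonempty → (Γ.Adj u (w i) ↔ Γ.Adj u (w j))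

section Contraction

variable {Γ : SimpleGraph ℕ} {S : Finset ℕ} {B : ℕ → Finset ℕ} {K : ℕ} {w : Fin (K + 2) → ℕ}

theorem BlockPartition.eq_of_mem (hB : BlockPartition Γ S B) {u v x : ℕ} (hu : x ∈ B u)
    (hv : x ∈ B v) : u = v := by
  by_contra h
  exact Finset.disjoint_left.1 (hB.disjoint u v h) hu hv

theorem BlockPartition.mem_of_nonempty (hB : BlockPartition Γ S B) {u : ℕ} (hu : (B u).Nonempty) :
    u ∈ S :=
  (hB.mem_iff u).2 ⟨u, hB.mem_self u hu⟩

theorem mem_contract {x u : ℕ} : x ∈ contract w B u ↔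
    (u = w 0 ∧ ∃ i, x ∈ B (w i)) ∨ ((∀ i, w i ≠ u) ∧ x ∈ B u) := by
  unfold contract
  split_ifs with h h'
  · simp only [Finset.mem_biUnion, Finset.mem_univ, true_and, h]
    exact ⟨Or.inl, fun h' => h'.elim id fun h' => (h'.1 0 rfl).elim⟩
  · obtain ⟨i, hi⟩ := h'
    simp only [Finset.notMem_empty, h, false_and, false_or, false_iff, not_and]
    exact fun h' => (h' i hi).elim
  · push Not at h'
    simp only [h, false_and, false_or, h', implies_true, true_and, ne_eq, not_false_eq_true]

theorem contract_nonempty_iff (hw : IsModuleTuple Γ B w) {u : ℕ} :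
    (contract w B u).Nonempty ↔ (B u).Nonempty ∧ ∀ i, i ≠ 0 → w i ≠ u := by
  constructor
  · rintro ⟨x, hx⟩
    rcases mem_contract.1 hx with ⟨rfl, -⟩ | ⟨h, hx⟩
    · exact ⟨hw.nonempty_zero, fun i hi h =>
        hw.eq_empty 0 i hi.symm h.symm hw.nonempty_zero⟩
    · exact ⟨⟨x, hx⟩, fun i _ => h i⟩
  · rintro ⟨⟨x, hx⟩, h⟩
    refine ⟨x, mem_contract.2 ?_⟩
    by_cases hu : u = w 0
    · exact Or.inl ⟨hu, 0, hu ▸ hx⟩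
    · refine Or.inr ⟨fun i hi => ?_, hx⟩
      by_cases h0 : i = 0
      · exact hu (h0 ▸ hi.symm)
      · exact h i h0 hi

theorem BlockPartition.contract (hB : BlockPartition Γ S B) (hw : IsModuleTuple Γ B w) :
    BlockPartition Γ S (contract w B) where
  disjoint u v huv := by
    rw [Finset.disjoint_left]
    intro x hu hv
    rcases mem_contract.1 hu with ⟨rfl, i, hi⟩ | ⟨h, hi⟩ <;>
      rcases mem_contract.1 hv with ⟨rfl, j, hj⟩ | ⟨h', hj⟩
    · exact huv rfl
    · exact h' i (hB.eq_of_mem hi hj)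
    · exact h j (hB.eq_of_mem hj hi)
    · exact huv (hB.eq_of_mem hi hj)
  mem_self u hu := by
    obtain ⟨h, h'⟩ := (contract_nonempty_iff hw).1 hu
    refine mem_contract.2 ?_
    by_cases h0 : u = w 0
    · exact Or.inl ⟨h0, 0, h0 ▸ hB.mem_self u h⟩
    · refine Or.inr ⟨fun i => ?_, hB.mem_self u h⟩
      by_cases hi : i = 0
      · exact hi ▸ Ne.symm h0
      · exact h' i hi
  mem_iff x := by
    rw [hB.mem_iff]
    constructor
    · rintro ⟨u, hu⟩
      by_cases h : ∃ i, w i = u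
      · obtain ⟨i, rfl⟩ := h
        exact ⟨w 0, mem_contract.2 (Or.inl ⟨rfl, i, hu⟩)⟩
      · push Not at h
        exact ⟨u, mem_contract.2 (Or.inr ⟨h, hu⟩)⟩
    · rintro ⟨u, hu⟩
      rcases mem_contract.1 hu with ⟨-, i, hi⟩ | ⟨-, hi⟩
      exacts [⟨_, hi⟩, ⟨_, hi⟩]
  adj_iff := by
    -- A representative outside the module does not distinguish the merged blocks.
    have key : ∀ u, (∀ i, w i ≠ u) → ∀ x ∈ B u, ∀ i, ∀ y ∈ B (w i),
        (Γ.Adj x y ↔ Γ.Adj u (w 0)) := fun u hu x hx i y hy =>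
      (hB.adj_iff u (w i) (hu i).symm x hx y hy).trans
        (hw.adj_iff u ⟨x, hx⟩ hu i 0 ⟨y, hy⟩ hw.nonempty_zero)
    intro u v huv x hx y hy
    rcases mem_contract.1 hx with ⟨rfl, i, hi⟩ | ⟨h, hi⟩ <;>
      rcases mem_contract.1 hy with ⟨rfl, j, hj⟩ | ⟨h', hj⟩
    · exact (huv rfl).elim
    · rw [Γ.adj_comm x y, Γ.adj_comm (w 0) v]
      exact key v h' y hj i x hi
    · exact key u h x hi j y hj
    · exact hB.adj_iff u v huv x hi y hj

/-- The number of representatives. -/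
def numBlocks (N : ℕ) (B : ℕ → Finset ℕ) : ℕ :=
  ((Finset.range N).filter fun u => (B u).Nonempty).card

theorem numBlocks_contract_lt {N : ℕ} (hw : IsModuleTuple Γ B w) (h1 : w 1 < N) :
    numBlocks N (contract w B) < numBlocks N B := by
  refine Finset.card_lt_card (Finset.ssubset_iff_of_subset ?_ |>.2 ⟨w 1, ?_, ?_⟩)
  · intro u hu
    simp only [Finset.mem_filter] at hu ⊢
    exact ⟨hu.1, ((contract_nonempty_iff hw).1 hu.2).1⟩
  · simpa using ⟨h1, hw.nonempty_one⟩
  · simp only [Finset.mem_filter, not_and]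
    exact fun _ h => ((contract_nonempty_iff hw).1 h).2 1 (by simp) rfl

/-- As long as there are two representatives, some module of bounded size can be contracted. The
entries of the tuple that are not needed are the number `N - 1`, which is not a vertex. -/
theorem exists_isModuleTuple {N : ℕ}
    (hΓ : ∀ A : Finset ℕ, (∀ u ∈ A, u + 1 < N) → 2 ≤ A.card → ∃ M ⊆ A, 2 ≤ M.card ∧
      M.card ≤ K + 2 ∧ ∀ u ∈ A, u ∉ M → ∀ x ∈ M, ∀ y ∈ M, (Γ.Adj u x ↔ Γ.Adj u y))
    (hS : ∀ u ∈ S, u + 1 < N) (hB : BlockPartition Γ S B) (h2 : 2 ≤ numBlocks N B) :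
    ∃ w : Fin (K + 2) → ℕ, (∀ i, w i < N) ∧ IsModuleTuple Γ B w := by
  obtain ⟨M, hMA, hM2, hMK, hM⟩ := hΓ ((Finset.range N).filter fun u => (B u).Nonempty)
    (fun u hu => hS u (hB.mem_of_nonempty (Finset.mem_filter.1 hu).2)) h2
  have hMB : ∀ u ∈ M, (B u).Nonempty := fun u hu => (Finset.mem_filter.1 (hMA hu)).2
  have hlen : M.toList.length = M.card := Finset.length_toList M
  have hN : 0 < N := by
    obtain ⟨u, hu⟩ := Finset.card_pos.1 (by omega : 0 < M.card)
    have := hS u (hB.mem_of_nonempty (hMB u hu))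
    omega
  have hdummy : ¬ (B (N - 1)).Nonempty := fun h => by
    have := hS _ (hB.mem_of_nonempty h)
    omega
  have hmem : ∀ i : ℕ, i < M.card → M.toList.getD i (N - 1) ∈ M := by
    intro i hi
    rw [List.getD_eq_getElem _ _ (by omega)]
    exact Finset.mem_toList.1 (List.getElem_mem _)
  have hge : ∀ i : ℕ, ¬ i < M.card → M.toList.getD i (N - 1) = N - 1 := fun i hi =>
    List.getD_eq_default _ _ (by omega)
  have hlt : ∀ i : ℕ, (B (M.toList.getD i (N - 1))).Nonempty → i < M.card := by
    intro i h
    by_contra hi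
    rw [hge i hi] at h
    exact hdummy h
  refine ⟨fun i => M.toList.getD i (N - 1), fun i => ?_, hMB _ (hmem _ ?_), hMB _ (hmem _ ?_),
    fun i j hij h hne => ?_, fun u hu hne i j hi hj => ?_⟩
  · by_cases hi : (i : ℕ) < M.card
    · exact Nat.lt_of_succ_lt (hS _ (hB.mem_of_nonempty (hMB _ (hmem i hi))))
    · exact (hge i hi).trans_lt (by omega)
  · simp only [Fin.val_zero]
    omega
  · simp only [Fin.val_one]
    omega
  · have hi := hlt _ hne
    have hj := hlt _ (h ▸ hne)
    rw [List.getD_eq_getElem _ _ (by omega), List.getD_eq_getElem _ _ (by omega),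
      M.nodup_toList.getElem_inj_iff] at h
    exact hij (Fin.ext h)
  · have huS := hS u (hB.mem_of_nonempty hu)
    refine hM u (Finset.mem_filter.2 ⟨Finset.mem_range.2 (by omega), hu⟩) (fun huM => ?_) _
      (hmem i (hlt _ hi)) _ (hmem j (hlt _ hj))
    obtain ⟨l, hl, rfl⟩ := List.getElem_of_mem (Finset.mem_toList.2 huM)
    exact hne ⟨l, by omega⟩ (List.getD_eq_getElem _ _ hl)

/-- The profile of the merged block. -/
theorem prof_contract {N : ℕ} (hB : BlockPartition Γ S B) (hw : IsModuleTuple Γ B w)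
    (hS : S.card < N) {c : Fin 3 → ℕ} : Γ.Prof (contract w B (w 0)) c ↔
      ∃ x : (Fin (K + 2) → Fin 4) → ℕ, (∀ f, x f < N) ∧
      (∀ f, x f ≠ 0 → ∑ i, (f i : ℕ) ≤ 3 ∧
        ∀ i j, i ≠ j → f i ≠ 0 → f j ≠ 0 → Γ.Adj (w i) (w j)) ∧
      (∀ i, Γ.Prof (B (w i)) fun j => ∑ f, if f i = j.succ then x f else 0) ∧
      ∀ j : Fin 3, c j = ∑ f, if ∑ i, (f i : ℕ) = j + 1 then x f else 0 := by
  have hne : ∀ i j, i ≠ j → ∀ x ∈ B (w i), w i ≠ w j := fun i j hij x hx h =>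
    hw.eq_empty i j hij h ⟨x, hx⟩
  rw [show contract w B (w 0) = Finset.univ.biUnion fun i => B (w i) from if_pos rfl]
  refine SimpleGraph.prof_biUnion (fun i j hij => ?_) (fun i j hij x hx y hy => ?_) ?_
  · rw [Finset.disjoint_left]
    exact fun x hx hx' => hne i j hij x hx (hB.eq_of_mem hx hx')
  · exact hB.adj_iff _ _ (hne i j hij x hx) x hx y hy
  · refine (Finset.card_le_card fun x hx => ?_).trans_lt hS
    obtain ⟨i, -, hi⟩ := Finset.mem_biUnion.1 hx
    exact (hB.mem_iff x).2 ⟨_, hi⟩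

/-- If there is at most one block, the blocks together have the same triangles as `S`. -/
theorem exists_prof_triangles_iff {N m : ℕ} (hS : ∀ u ∈ S, u + 1 < N) (hB : BlockPartition Γ S B)
    (h1 : numBlocks N B ≤ 1) (hm : m ≠ 0) :
    (∃ u < N, Γ.Prof (B u) ![0, 0, m]) ↔ m ≤ Γ.packNum S := by
  have huniq : ∀ u v, (B u).Nonempty → (B v).Nonempty → u = v := by
    intro u v hu hv
    have h := fun u (hu : (B u).Nonempty) => hS u (hB.mem_of_nonempty hu)
    refine Finset.card_le_one.1 h1 u ?_ v ?_ <;> rw [Finset.mem_filter, Finset.mem_range]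
    exacts [⟨Nat.lt_of_succ_lt (h u hu), hu⟩, ⟨Nat.lt_of_succ_lt (h v hv), hv⟩]
  have hBS : ∀ u, (B u).Nonempty → B u = S := by
    intro u hu
    ext x
    rw [hB.mem_iff]
    exact ⟨fun h => ⟨u, h⟩, fun ⟨v, hv⟩ => huniq u v hu ⟨x, hv⟩ ▸ hv⟩
  have hpos : ∀ C : Finset ℕ, Γ.Prof C ![0, 0, m] → C.Nonempty := by
    intro C hC
    rw [← Finset.card_pos]
    exact (Nat.pos_of_ne_zero hm).trans_le (hC.le_card 2)
  constructor
  · rintro ⟨u, -, hu⟩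
    exact SimpleGraph.prof_triangles_iff_le.1 (hBS u (hpos _ hu) ▸ hu)
  · intro h
    have h' := SimpleGraph.prof_triangles_iff_le.2 h
    obtain ⟨x, hx⟩ := hpos _ h'
    obtain ⟨u, hu⟩ := (hB.mem_iff x).1 hx
    exact ⟨u, Nat.lt_of_succ_lt (hS u (hB.mem_of_nonempty ⟨x, hu⟩)), (hBS u ⟨x, hu⟩).symm ▸ h'⟩

theorem blockPartition_singletons (Γ : SimpleGraph ℕ) (S : Finset ℕ) :
    BlockPartition Γ S fun u => if u ∈ S then {u} else ∅ where
  disjoint u v huv := by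
    split_ifs <;> simp [huv]
  mem_self u hu := by
    split_ifs with h
    · simp
    · simp [h] at hu
  mem_iff x := by
    constructor
    · exact fun h => ⟨x, by simp [h]⟩
    · rintro ⟨u, hu⟩
      split_ifs at hu with h
      · rwa [Finset.mem_singleton.1 hu]
      · simp at hu
  adj_iff u v _ x hx y hy := by
    split_ifs at hx hy
    · rw [Finset.mem_singleton.1 hx, Finset.mem_singleton.1 hy]
    all_goals simp at hx hy

end Contraction

/-! ### Tables of profiles -/

/-- The value of the expression does not depend on the variable `aux 0`, which is reserved for
multiplication by the bound. -/
def Exp.Fresh (e : Exp) : Prop :=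
  ∀ N A η i, e.eval N A (Function.update η (.aux 0) i) = e.eval N A η

theorem Exp.fresh_var {x : Name} (hx : x ≠ .aux 0) : (Exp.var x).Fresh := by
  intro N A η i
  simp [Exp.eval, hx]

theorem Exp.fresh_const (c : ℕ) : (Exp.const c).Fresh := fun _ _ _ _ => rfl

theorem Exp.Fresh.add {e f : Exp} (he : e.Fresh) (hf : f.Fresh) : (Exp.add e f).Fresh := by
  intro N A η i
  rw [Exp.eval, he, hf, Exp.eval]

theorem Exp.fresh_mulBound (e : Exp) : (Exp.mulBound e).Fresh := by
  intro N A η i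
  simp only [Exp.mulBound, Exp.eval, Function.update_idem]

theorem Exp.Fresh.eval_mulBound {e : Exp} (he : e.Fresh) {N : ℕ} {A : Store} {η : Env} :
    (Exp.mulBound e).eval N A η = e.eval N A η * N :=
  Exp.eval_mulBound fun i => he N A η i

theorem Exp.fresh_fsum {ι : Type} [Fintype ι] {e : ι → Exp} (he : ∀ i, (e i).Fresh) :
    (Exp.fsum e).Fresh := by
  intro N A η i
  rw [Exp.eval_fsum, Exp.eval_fsum]
  exact Finset.sum_congr rfl fun j _ => he j N A η i

/-- The position of the entry for the vertex `u` and the triple `c` in a table. -/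
def key (N u : ℕ) (c : Fin 3 → ℕ) : ℕ := ((u * N + c 0) * N + c 1) * N + c 2

theorem mul_add_inj {N a b x y : ℕ} (hx : x < N) (hy : y < N) (h : a * N + x = b * N + y) :
    a = b ∧ x = y := by
  have hN : 0 < N := by omega
  have h₁ := congrArg (· % N) h
  simp only [Nat.mul_add_mod', Nat.mod_eq_of_lt hx, Nat.mod_eq_of_lt hy] at h₁
  subst h₁
  exact ⟨Nat.eq_of_mul_eq_mul_right hN (Nat.add_right_cancel h), rfl⟩

theorem key_inj {N u v : ℕ} {c d : Fin 3 → ℕ} (hc : ∀ j, c j < N) (hd : ∀ j, d j < N)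
    (h : key N u c = key N v d) : u = v ∧ c = d := by
  obtain ⟨h, h2⟩ := mul_add_inj (hc 2) (hd 2) h
  obtain ⟨h, h1⟩ := mul_add_inj (hc 1) (hd 1) h
  obtain ⟨h, h0⟩ := mul_add_inj (hc 0) (hd 0) h
  refine ⟨h, funext fun j => ?_⟩
  fin_cases j
  exacts [h0, h1, h2]

/-- The expression for `key`. -/
def keyE (u : Exp) (c : Fin 3 → Exp) : Exp :=
  .add (.mulBound (.add (.mulBound (.add (.mulBound u) (c 0))) (c 1))) (c 2)

theorem eval_keyE {u : Exp} {c : Fin 3 → Exp} (hu : u.Fresh) (hc : ∀ j, (c j).Fresh) {N : ℕ}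
    {A : Store} {η : Env} :
    (keyE u c).eval N A η = key N (u.eval N A η) fun j => (c j).eval N A η := by
  simp only [keyE, key, Exp.eval, ((Exp.fresh_mulBound _).add (hc 1)).eval_mulBound,
    ((Exp.fresh_mulBound _).add (hc 0)).eval_mulBound, hu.eval_mulBound]

/-- The expression for the bound `N`. -/
def boundE : Exp := .mulBound (.const 1)

@[simp] theorem eval_boundE {N : ℕ} {A : Store} {η : Env} : boundE.eval N A η = N := by
  simp [boundE, (Exp.fresh_const 1).eval_mulBound, Exp.eval]

/-- The array `M` holds the adjacency matrix of `Γ`, whose vertices are less than `N - 1`, with rows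
of length `N - 1`. The index `u * N - u + v` is `u * (N - 1) + v` in a form that needs
multiplication by `N` only. Without the condition on `v` it would run into the next row. -/
def AdjArray (Γ : SimpleGraph ℕ) (N : ℕ) (M : ℕ → ℕ) : Prop :=
  ∀ u < N, ∀ v < N, (Γ.Adj u v ↔ v < N - 1 ∧ M (u * N - u + v) ≠ 0)

/-- The formula for adjacency. -/
def adjE (x y : Name) : Exp :=
  .and (.lt (.var y) (.sub boundE (.const 1)))
    (.get 0 (.add (.sub (.mulBound (.var x)) (.var x)) (.var y)))

theorem holds_adjE {Γ : SimpleGraph ℕ} {N : ℕ} {A : Store} {η : Env} (hA : AdjArray Γ N (A 0))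
    {x y : Name} (hx : x ≠ .aux 0) (hxN : η x < N) (hyN : η y < N) :
    (adjE x y).Holds N A η ↔ Γ.Adj (η x) (η y) := by
  rw [hA _ hxN _ hyN]
  simp [adjE, Exp.eval, (Exp.fresh_var hx).eval_mulBound]

/-- Arrays `3` and `4` hold the representatives of the partition `B` and the profiles of its
blocks. -/
structure TableRep (Γ : SimpleGraph ℕ) (N : ℕ) (S : Finset ℕ) (A : Store) (B : ℕ → Finset ℕ) :
    Prop where
  partition : BlockPartition Γ S B
  adj : AdjArray Γ N (A 0)
  active : ∀ u < N, A 3 u ≠ 0 ↔ (B u).Nonempty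
  table : ∀ u < N, (B u).Nonempty → ∀ c : Fin 3 → ℕ, (∀ j, c j < N) →
    (A 4 (key N u c) ≠ 0 ↔ Γ.Prof (B u) c)

theorem TableRep.congr {Γ : SimpleGraph ℕ} {N : ℕ} {S : Finset ℕ} {A A' : Store}
    {B : ℕ → Finset ℕ} (h : TableRep Γ N S A B) (h0 : A' 0 = A 0) (h3 : A' 3 = A 3)
    (h4 : A' 4 = A 4) : TableRep Γ N S A' B :=
  ⟨h.partition, h0 ▸ h.adj, h3 ▸ h.active, h4 ▸ h.table⟩

/-- The formula for `c` being in the profile of the block of `x`, which may be empty. -/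
noncomputable def profE (x : Name) (c : Fin 3 → Exp) : Exp :=
  .and (.fall fun j => .lt (c j) boundE)
    (.or (.and (.get 3 (.var x)) (.get 4 (keyE (.var x) c)))
      (.and (.not (.get 3 (.var x))) (.fall fun j => .eq (c j) (.const 0))))

theorem TableRep.holds_profE {Γ : SimpleGraph ℕ} {N : ℕ} {S : Finset ℕ} {A : Store}
    {B : ℕ → Finset ℕ} (h : TableRep Γ N S A B) (hS : S.card < N) {η : Env} {x : Name}
    (hx : x ≠ .aux 0) (hxN : η x < N) {c : Fin 3 → Exp} (hc : ∀ j, (c j).Fresh) :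
    (profE x c).Holds N A η ↔ Γ.Prof (B (η x)) fun j => (c j).eval N A η := by
  have hlt : (Γ.Prof (B (η x)) fun j => (c j).eval N A η) → ∀ j, (c j).eval N A η < N := by
    intro hp j
    refine ((hp.le_card j).trans (Finset.card_le_card fun y hy => ?_)).trans_lt hS
    exact (h.partition.mem_iff y).2 ⟨_, hy⟩
  simp only [profE, Exp.holds_and, Exp.holds_fall, Exp.holds_lt, eval_boundE, Exp.holds_or,
    Exp.holds_get, Exp.holds_not, Exp.holds_eq, eval_keyE (Exp.fresh_var hx) hc, Exp.eval,
    h.active _ hxN]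
  by_cases hne : (B (η x)).Nonempty
  · simp only [hne, true_and, not_true_eq_false, false_and, or_false]
    refine ⟨fun ⟨h₁, h₂⟩ => (h.table _ hxN hne _ h₁).1 h₂, fun hp => ⟨hlt hp, ?_⟩⟩
    exact (h.table _ hxN hne _ (hlt hp)).2 hp
  · simp only [hne, false_and, not_false_eq_true, true_and, false_or]
    rw [Finset.not_nonempty_iff_eq_empty] at hne
    rw [hne, SimpleGraph.prof_empty]
    exact ⟨fun h => h.2, fun h => ⟨fun j => by rw [h j]; omega, h⟩⟩

/-! ### The formulas for a contraction -/

section Formulas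

variable (K : ℕ)

/-- A numbering of the types of cliques. -/
noncomputable def typeIndex (f : Fin (K + 2) → Fin 4) : ℕ := Fintype.equivFin _ f

theorem typeIndex_injective : Function.Injective (typeIndex K) := fun _ _ h =>
  (Fintype.equivFin _).injective (Fin.ext h)

/-- The variable for the number of cliques of type `f`. -/
noncomputable def multE (f : Fin (K + 2) → Fin 4) : Exp := .var (.mult (typeIndex K f))

/-- The variables for the members of the tuple. -/
def slots : List Name := List.ofFn fun i : Fin (K + 2) => .slot i

/-- The variables for the numbers of cliques of the types. -/
noncomputable def mults : List Name :=
  (Finset.univ : Finset (Fin (K + 2) → Fin 4)).toList.map fun f => .mult (typeIndex K f)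

/-- The variables for a triple. -/
def triple : List Name := [.aux 1, .aux 2, .aux 3]

/-- The formula for the variables `slot i` being a module of representatives. -/
noncomputable def moduleE : Exp :=
  .and (.get 3 (.var (.slot 0))) (.and (.get 3 (.var (.slot 1))) (.and
    (.fall fun i : Fin (K + 2) => .fall fun j : Fin (K + 2) =>
      .or (.const (if i = j then 1 else 0)) (.or (.not (.eq (.var (.slot i)) (.var (.slot j))))
        (.not (.get 3 (.var (.slot i))))))
    (.all (.aux 4) (.or (.not (.and (.get 3 (.var (.aux 4)))
        (.fall fun i : Fin (K + 2) => .not (.eq (.var (.slot i)) (.var (.aux 4))))))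
      (.fall fun i : Fin (K + 2) => .fall fun j : Fin (K + 2) =>
        .or (.not (.and (.get 3 (.var (.slot i))) (.get 3 (.var (.slot j)))))
          (.or (.and (adjE (.aux 4) (.slot i)) (adjE (.aux 4) (.slot j)))
            (.and (.not (adjE (.aux 4) (.slot i))) (.not (adjE (.aux 4) (.slot j))))))))))

/-- The formula for the multiplicities being possible numbers of cliques of each type in the union
of the blocks of the `slot i`, and yielding the triple of `aux 1`, `aux 2`, `aux 3`. -/
noncomputable def countsE : Exp :=
  .and
    (.fall fun f : Fin (K + 2) → Fin 4 => .or (.eq (multE K f) (.const 0)) (.and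
      (.lt (.const (∑ i, (f i : ℕ))) (.const 4))
      (.fall fun i : Fin (K + 2) => .fall fun j : Fin (K + 2) =>
        .or (.const (if i ≠ j ∧ f i ≠ 0 ∧ f j ≠ 0 then 0 else 1)) (adjE (.slot i) (.slot j)))))
    (.and
      (.fall fun i : Fin (K + 2) => profE (.slot i) fun j =>
        .fsum fun f : Fin (K + 2) → Fin 4 => if f i = j.succ then multE K f else .const 0)
      (.fall fun j : Fin 3 => .eq (.var (.aux (j + 1)))
        (.fsum fun f : Fin (K + 2) → Fin 4 =>
          if ∑ i, (f i : ℕ) = j + 1 then multE K f else .const 0)))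

/-- The formula for the triple of `aux 1`, `aux 2`, `aux 3` being in the profile of the union of the
blocks of the `slot i`. -/
noncomputable def mergeE : Exp := .exs (mults K) (countsE K)

variable {K} {Γ : SimpleGraph ℕ} {N : ℕ} {S : Finset ℕ} {A : Store} {B : ℕ → Finset ℕ}

theorem holds_const {c : ℕ} {η : Env} : (Exp.const c).Holds N A η ↔ c ≠ 0 := Iff.rfl

theorem TableRep.holds_moduleE (h : TableRep Γ N S A B) (hS : ∀ u ∈ S, u + 1 < N) {η : Env}
    (hη : ∀ i : Fin (K + 2), η (.slot i) < N) :
    (moduleE K).Holds N A η ↔ IsModuleTuple Γ B fun i : Fin (K + 2) => η (.slot i) := by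
  have hadj : ∀ u < N, ∀ i : Fin (K + 2),
      (adjE (.aux 4) (.slot i)).Holds N A (Function.update η (.aux 4) u) ↔
        Γ.Adj u (η (.slot i)) := by
    intro u hu i
    rw [holds_adjE h.adj (by simp) (by simpa using hu) (by simpa using hη i)]
    simp
  have h0 := hη 0
  have h1 := hη 1
  simp only [Fin.val_zero, Fin.val_one] at h0 h1
  have hall : ∀ p : ℕ → Prop, (∀ u < N, (A 3 u ≠ 0 → p u)) ↔ ∀ u, (B u).Nonempty → p u := by
    intro p
    constructor
    · intro hp u hu
      have := hS u (h.partition.mem_of_nonempty hu)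
      exact hp u (by omega) ((h.active u (by omega)).2 hu)
    · exact fun hp u hu h3 => hp u ((h.active u hu).1 h3)
  have hiff : IsModuleTuple Γ B (fun i : Fin (K + 2) => η (.slot i)) ↔
      (B (η (.slot 0))).Nonempty ∧ (B (η (.slot 1))).Nonempty ∧
      (∀ i j : Fin (K + 2), i ≠ j → η (.slot i) = η (.slot j) → ¬ (B (η (.slot i))).Nonempty) ∧
      ∀ u, (B u).Nonempty → (∀ i : Fin (K + 2), η (.slot i) ≠ u) → ∀ i j : Fin (K + 2),
        (B (η (.slot i))).Nonempty → (B (η (.slot j))).Nonempty →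
          (Γ.Adj u (η (.slot i)) ↔ Γ.Adj u (η (.slot j))) :=
    ⟨fun ⟨a, b, c, d⟩ => ⟨a, b, c, d⟩, fun ⟨a, b, c, d⟩ => ⟨a, b, c, d⟩⟩
  rw [hiff, ← hall]
  simp only [moduleE, Exp.holds_and, Exp.holds_get, Exp.holds_fall, Exp.holds_or, Exp.holds_not,
    Exp.holds_eq, Exp.holds_all, Exp.eval, holds_const, Function.update_self, ne_eq, reduceCtorEq,
    not_false_eq_true, Function.update_of_ne]
  simp only [← ne_eq, h.active _ h0, h.active _ h1, h.active _ (hη _)]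
  refine and_congr_right fun _ => and_congr_right fun _ => and_congr ?_ ?_
  · refine forall_congr' fun i => forall_congr' fun j => ?_
    by_cases hij : i = j
    · simp [hij]
    · simp [hij, imp_iff_not_or]
  · refine forall_congr' fun u => forall_congr' fun hu => ?_
    constructor
    · intro hh h3 hne i j hi hj
      have := (hh.resolve_left (not_not.2 ⟨h3, hne⟩) i j).resolve_left (not_not.2 ⟨hi, hj⟩)
      rw [hadj u hu i, hadj u hu j] at this
      tauto
    · intro hh
      by_cases hc : A 3 u ≠ 0 ∧ ∀ i : Fin (K + 2), η (.slot i) ≠ u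
      · refine Or.inr fun i j => ?_
        by_cases hij : (B (η (.slot i))).Nonempty ∧ (B (η (.slot j))).Nonempty
        · right
          rw [hadj u hu i, hadj u hu j]
          have := hh hc.1 hc.2 i j hij.1 hij.2
          tauto
        · exact Or.inl hij
      · exact Or.inl hc

theorem TableRep.holds_countsE (h : TableRep Γ N S A B) (hS : S.card < N) {ζ : Env}
    (hζ : ∀ i : Fin (K + 2), ζ (.slot i) < N) :
    (countsE K).Holds N A ζ ↔
      (∀ f : Fin (K + 2) → Fin 4, ζ (.mult (typeIndex K f)) = 0 ∨ ∑ i, (f i : ℕ) < 4 ∧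
        ∀ i j, (if i ≠ j ∧ f i ≠ 0 ∧ f j ≠ 0 then 0 else 1) ≠ 0 ∨
          Γ.Adj (ζ (.slot i)) (ζ (.slot j))) ∧
      (∀ i : Fin (K + 2), Γ.Prof (B (ζ (.slot i))) fun j => ∑ f : Fin (K + 2) → Fin 4,
        if f i = j.succ then ζ (.mult (typeIndex K f)) else 0) ∧
      ∀ j : Fin 3, ζ (.aux (j + 1)) = ∑ f : Fin (K + 2) → Fin 4,
        if ∑ i, (f i : ℕ) = j + 1 then ζ (.mult (typeIndex K f)) else 0 := by
  have hfresh : ∀ p : (Fin (K + 2) → Fin 4) → Prop, ∀ [DecidablePred p],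
      (Exp.fsum fun f => if p f then multE K f else .const 0).Fresh := by
    intro p _
    refine Exp.fresh_fsum fun f => ?_
    split_ifs
    · exact Exp.fresh_var (by simp)
    · exact Exp.fresh_const 0
  have heval : ∀ (p : (Fin (K + 2) → Fin 4) → Prop) [DecidablePred p],
      (Exp.fsum fun f => if p f then multE K f else .const 0).eval N A ζ =
        ∑ f, if p f then ζ (.mult (typeIndex K f)) else 0 := by
    intro p _
    rw [Exp.eval_fsum]
    refine Finset.sum_congr rfl fun f _ => ?_
    split_ifs <;> rfl
  have hadj : ∀ i j : Fin (K + 2), (adjE (.slot i) (.slot j)).Holds N A ζ ↔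
      Γ.Adj (ζ (.slot i)) (ζ (.slot j)) := fun i j =>
    holds_adjE h.adj (by simp) (hζ i) (hζ j)
  have hprof : ∀ i : Fin (K + 2), (profE (.slot i) fun j => .fsum fun f : Fin (K + 2) → Fin 4 =>
      if f i = j.succ then multE K f else .const 0).Holds N A ζ ↔
      Γ.Prof (B (ζ (.slot i))) fun j => ∑ f : Fin (K + 2) → Fin 4,
        if f i = j.succ then ζ (.mult (typeIndex K f)) else 0 := fun i => by
    rw [h.holds_profE hS (by simp) (hζ i) fun j => hfresh fun f => f i = j.succ]
    simp only [heval]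
  rw [countsE, Exp.holds_and, Exp.holds_and, Exp.holds_fall, Exp.holds_fall, Exp.holds_fall]
  simp only [Exp.holds_or, Exp.holds_eq, Exp.holds_and, Exp.holds_lt, Exp.holds_fall, hadj, hprof,
    heval, holds_const, Exp.eval]
  rfl

theorem holds_mergeE (h : TableRep Γ N S A B) (hS : S.card < N) {η : Env}
    (hη : ∀ i : Fin (K + 2), η (.slot i) < N)
    (hw : IsModuleTuple Γ B fun i : Fin (K + 2) => η (.slot i)) :
    (mergeE K).Holds N A η ↔
      Γ.Prof (contract (fun i : Fin (K + 2) => η (.slot i)) B (η (.slot 0)))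
        fun j => η (.aux (j + 1)) := by
  have hslot : ∀ ζ ∈ Box N (mults K) η, ∀ i, ζ (.slot i) = η (.slot i) := fun ζ hζ i =>
    hζ.1 _ (by simp [mults])
  have haux : ∀ ζ ∈ Box N (mults K) η, ∀ i, ζ (.aux i) = η (.aux i) := fun ζ hζ i =>
    hζ.1 _ (by simp [mults])
  have hζN : ∀ ζ ∈ Box N (mults K) η, ∀ i : Fin (K + 2), ζ (.slot i) < N := fun ζ hζ i =>
    hslot ζ hζ i ▸ hη i
  have hprof := prof_contract h.partition hw hS (c := fun j => η (.aux (j + 1)))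
  simp only [Fin.val_zero] at hprof
  rw [hprof, mergeE, Exp.holds_exs]
  constructor
  · rintro ⟨ζ, hζ, hh⟩
    have hh' := (h.holds_countsE hS (hζN ζ hζ)).1 hh
    refine ⟨fun f => ζ (.mult (typeIndex K f)), fun f => hζ.2 _ (by simp [mults]), ?_⟩
    simp only [hslot ζ hζ, haux ζ hζ] at hh'
    obtain ⟨h₃, h₄, h₅⟩ := hh'
    refine ⟨fun f hf => ?_, h₄, h₅⟩
    obtain ⟨h₆, h₇⟩ := (h₃ f).resolve_left hf
    refine ⟨by omega, fun i j hij hi hj => (h₇ i j).resolve_left ?_⟩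
    simp [hij, hi, hj]
  · rintro ⟨x, hxN, hx, hxB, hxc⟩
    let ζ : Env := fun y => match y with
      | .mult i => Function.extend (typeIndex K) x (fun i => η (.mult i)) i
      | y => η y
    have hζx : ∀ f, ζ (.mult (typeIndex K f)) = x f := fun f =>
      (typeIndex_injective K).extend_apply _ _ _
    have hζ : ζ ∈ Box N (mults K) η := by
      constructor
      · intro y hy
        cases y with
        | aux i => rfl
        | slot i => rfl
        | mult i =>
          simp only [mults, List.mem_map, Finset.mem_toList, Finset.mem_univ, true_and,
            Name.mult.injEq, not_exists] at hy
          exact Function.extend_apply' _ _ _ fun ⟨f, hf⟩ => hy f hf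
      · intro y hy
        simp only [mults, List.mem_map, Finset.mem_toList, Finset.mem_univ, true_and] at hy
        obtain ⟨f, rfl⟩ := hy
        exact (hζx f).trans_lt (hxN f)
    refine ⟨ζ, hζ, (h.holds_countsE hS (hζN ζ hζ)).2 ?_⟩
    simp only [hslot ζ hζ, haux ζ hζ, hζx]
    refine ⟨fun f => ?_, hxB, hxc⟩
    by_cases hf : x f = 0
    · exact Or.inl hf
    · obtain ⟨h₆, h₇⟩ := hx f hf
      refine Or.inr ⟨by omega, fun i j => ?_⟩
      by_cases hij : i ≠ j ∧ f i ≠ 0 ∧ f j ≠ 0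
      · exact Or.inr (h₇ i j hij.1 hij.2.1 hij.2.2)
      · exact Or.inl (by simp [hij])

end Formulas

/-! ### The commands for the packing number -/

section Commands

variable (K : ℕ)

/-- The triple of variables as expressions. -/
def tripleE (j : Fin 3) : Exp := .var (.aux (j + 1))

/-- Marks the vertices `slot i`, for `i` in a list, as not being representatives. -/
def clearCmd : List (Fin (K + 2)) → Cmd
  | [] => .skip
  | i :: l => .seq (.put 3 (.var (.slot i)) (.const 0)) (clearCmd l)

/-- Computes the profile of the union of the blocks of the `slot i` in array `5`, stores it as the
profile of `slot 0`, and marks the other `slot i` as not being representatives. -/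
noncomputable def contractCmd : Cmd :=
  .seq (.loops triple (.put 5 (keyE (.const 0) tripleE) (.ind (mergeE K))))
    (.seq (.loops triple (.put 4 (keyE (.var (.slot 0)) tripleE)
        (.get 5 (keyE (.const 0) tripleE))))
      (clearCmd K (Finset.univ.toList.filter (· ≠ 0))))

/-- Contracts modules until there is at most one representative. -/
noncomputable def contractAllCmd : Cmd :=
  .loop (.aux 5) (.loops (slots K) (.ifnz (moduleE K) (contractCmd K)))

/-- Sets up the partition into singletons of the set that is given in array `2`. -/
noncomputable def initCmd : Cmd :=
  .seq (.loops [.aux 4] (.put 3 (.var (.aux 4)) (.get 2 (.var (.aux 4)))))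
    (.loops (.aux 4 :: triple) (.put 4 (keyE (.var (.aux 4)) tripleE)
      (.ind (.and (.lt (tripleE 0) (.const 2)) (.and (.eq (tripleE 1) (.const 0))
        (.eq (tripleE 2) (.const 0)))))))

/-- Computes the packing number of the set that is given in array `2` in entry `0` of
array `6`. -/
noncomputable def packNumCmd : Cmd :=
  .seq initCmd (.seq (contractAllCmd K) (.put 6 (.const 0)
    (.sum (.aux 3) (.ind (.and (.lt (.const 0) (.var (.aux 3)))
      (.ex (.aux 4) (profE (.aux 4) ![.const 0, .const 0, .var (.aux 3)])))))))

variable {K} {Γ : SimpleGraph ℕ} {N : ℕ} {S : Finset ℕ} {A : Store} {B : ℕ → Finset ℕ}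

theorem fresh_tripleE (j : Fin 3) : (tripleE j).Fresh := Exp.fresh_var (by simp)

theorem triple_lt {η ζ : Env} (hζ : ζ ∈ Box N triple η) (j : Fin 3) : ζ (.aux (j + 1)) < N := by
  refine hζ.2 _ ?_
  fin_cases j <;> simp [triple]

theorem exists_mem_box_triple (η : Env) {c : Fin 3 → ℕ} (hc : ∀ j, c j < N) :
    ∃ ζ ∈ Box N triple η, (fun j : Fin 3 => ζ (.aux (j + 1))) = c := by
  refine ⟨Function.update (Function.update (Function.update η (.aux 1) (c 0)) (.aux 2) (c 1))
    (.aux 3) (c 2), mem_box_cons.2 ⟨_, hc 0, mem_box_cons.2 ⟨_, hc 1, mem_box_cons.2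
      ⟨_, hc 2, by rw [box_nil]; rfl⟩⟩⟩, ?_⟩
  funext j
  fin_cases j <;> simp

theorem run_clearCmd {η : Env} (l : List (Fin (K + 2))) (A : Store) :
    (∀ b, b ≠ 3 → (clearCmd K l).run N η A b = A b) ∧
      ∀ u, (clearCmd K l).run N η A 3 u ≠ 0 ↔ A 3 u ≠ 0 ∧ ∀ i ∈ l, η (.slot i) ≠ u := by
  induction l generalizing A with
  | nil => simp [clearCmd, Cmd.run]
  | cons i l ih =>
    simp only [clearCmd, Cmd.run, Exp.eval]
    obtain ⟨h₁, h₂⟩ := ih (Function.update A 3 (Function.update (A 3) (η (.slot i)) 0))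
    refine ⟨fun b hb => by rw [h₁ b hb, Function.update_of_ne hb], fun u => ?_⟩
    rw [h₂]
    by_cases hu : u = η (.slot i)
    · simp [hu]
    · simp [hu, Ne.symm hu]

open Classical in
theorem TableRep.run_contractCmd (h : TableRep Γ N S A B) (hS : S.card < N) {η : Env}
    (hη : ∀ i : Fin (K + 2), η (.slot i) < N)
    (hw : IsModuleTuple Γ B fun i : Fin (K + 2) => η (.slot i)) :
    TableRep Γ N S ((contractCmd K).run N η A)
      (contract (fun i : Fin (K + 2) => η (.slot i)) B) := by
  set w : Fin (K + 2) → ℕ := fun i => η (.slot i) with hwdef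
  have hbox : ∀ ζ ∈ Box N triple η, ∀ i, ζ (.slot i) = η (.slot i) := fun ζ hζ i =>
    hζ.1 _ (by simp [triple])
  have hcongr : ∀ {u v : ℕ} {ζ ξ : Env}, ζ ∈ Box N triple η → ξ ∈ Box N triple η →
      key N u (fun j : Fin 3 => ζ (.aux (j + 1))) = key N v (fun j : Fin 3 => ξ (.aux (j + 1))) →
      (fun j : Fin 3 => ζ (.aux (j + 1))) = fun j : Fin 3 => ξ (.aux (j + 1)) :=
    fun hζ hξ hk => (key_inj (triple_lt hζ) (triple_lt hξ) hk).2
  -- The profile of the union is computed in array `5`.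
  have h₁ := Cmd.filled_loops_put (N := N) (a := 5) (xs := triple) (i := keyE (.const 0) tripleE)
    (e := .ind (mergeE K)) (η := η) (k := fun ζ => key N 0 fun j : Fin 3 => ζ (.aux (j + 1)))
    (v := fun ζ => if Γ.Prof (contract w B (w 0)) fun j : Fin 3 => ζ (.aux (j + 1)) then 1 else 0)
    (A₀ := A) (fun ζ hζ A' hA' => by
      refine ⟨?_, ?_⟩
      · rw [eval_keyE (Exp.fresh_const 0) fresh_tripleE]
        rfl
      · have hζw : (fun i : Fin (K + 2) => ζ (.slot i)) = w := funext fun i => hbox ζ hζ i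
        rw [Exp.eval_ind, holds_mergeE (h.congr (hA' 0 (by simp)) (hA' 3 (by simp))
          (hA' 4 (by simp))) hS (fun i => hbox ζ hζ i ▸ hη i) (hζw ▸ hw), hζw, hbox ζ hζ]
        rfl) (fun b _ => rfl)
  set A₁ := (Cmd.loops triple (.put 5 (keyE (.const 0) tripleE) (.ind (mergeE K)))).run N η A
  have h₂ := Cmd.filled_loops_put (N := N) (a := 4) (xs := triple)
    (i := keyE (.var (.slot 0)) tripleE) (e := .get 5 (keyE (.const 0) tripleE)) (η := η)
    (k := fun ζ => key N (w 0) fun j : Fin 3 => ζ (.aux (j + 1)))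
    (v := fun ζ => A₁ 5 (key N 0 fun j : Fin 3 => ζ (.aux (j + 1))))
    (A₀ := A₁) (fun ζ hζ A' hA' => by
      refine ⟨?_, ?_⟩
      · rw [eval_keyE (Exp.fresh_var (by simp)) fresh_tripleE, Exp.eval, hbox ζ hζ]
        rfl
      · rw [Exp.eval, eval_keyE (Exp.fresh_const 0) fresh_tripleE, hA' 5 (by simp)]
        rfl) (fun b _ => rfl)
  set A₂ := (Cmd.loops triple (.put 4 (keyE (.var (.slot 0)) tripleE)
    (.get 5 (keyE (.const 0) tripleE)))).run N η A₁
  obtain ⟨h₃, h₃'⟩ := run_clearCmd (N := N) (η := η)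
    ((Finset.univ : Finset (Fin (K + 2))).toList.filter (· ≠ 0)) A₂
  have hrun : (contractCmd K).run N η A =
      (clearCmd K (Finset.univ.toList.filter (· ≠ 0))).run N η A₂ := rfl
  rw [hrun]
  set A₃ := (clearCmd K (Finset.univ.toList.filter (· ≠ 0))).run N η A₂
  have hA3 : A₂ 3 = A 3 := (h₂.1 3 (by simp)).trans (h₁.1 3 (by simp))
  refine ⟨h.partition.contract hw, ?_, fun u hu => ?_, fun u hu hne c hc => ?_⟩
  · rw [h₃ 0 (by simp), h₂.1 0 (by simp), h₁.1 0 (by simp)]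
    exact h.adj
  · rw [h₃' u, hA3, h.active u hu, contract_nonempty_iff hw]
    simp [w]
  · rw [h₃ 4 (by simp)]
    by_cases hu0 : u = w 0
    · obtain ⟨ζ, hζ, rfl⟩ := exists_mem_box_triple η hc
      rw [hu0, h₂.apply (fun ζ hζ ξ hξ hk => by rw [hcongr hζ hξ hk]) hζ,
        h₁.apply (fun ζ hζ ξ hξ hk => by rw [hcongr hζ hξ hk]) hζ]
      split_ifs with hp <;> simp [hp]
    · have hnew : contract w B u = B u := by
        have := ((contract_nonempty_iff hw).1 hne).2
        rw [contract, if_neg hu0, if_neg]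
        rintro ⟨i, rfl⟩
        exact this i (fun hi => hu0 (by rw [hi])) rfl
      rw [h₂.apply_of_ne fun ζ hζ hk => hu0 (key_inj (triple_lt hζ) hc hk).1.symm,
        h₁.1 4 (by simp), hnew]
      exact h.table u hu (hnew ▸ hne) c hc

theorem card_lt_of_forall_lt (hS : ∀ u ∈ S, u + 1 < N) (hN : 0 < N) : S.card < N := by
  have : S ⊆ Finset.range (N - 1) := fun u hu => by
    have := hS u hu
    simp only [Finset.mem_range]
    omega
  have := Finset.card_le_card this
  simp only [Finset.card_range] at this
  omega

/-- The graph on `{0, …, N - 2}` has small modules everywhere: each induced subgraph with at least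
two vertices has a module with at least `2` and at most `K + 2` elements. -/
def HasSmallModules (Γ : SimpleGraph ℕ) (N K : ℕ) : Prop :=
  ∀ A : Finset ℕ, (∀ u ∈ A, u + 1 < N) → 2 ≤ A.card → ∃ M ⊆ A, 2 ≤ M.card ∧
    M.card ≤ K + 2 ∧ ∀ u ∈ A, u ∉ M → ∀ x ∈ M, ∀ y ∈ M, (Γ.Adj u x ↔ Γ.Adj u y)

theorem TableRep.run_contractAllCmd (hΓ : HasSmallModules Γ N K) (h : TableRep Γ N S A B)
    (hS : ∀ u ∈ S, u + 1 < N) (hN : 0 < N) (η : Env) :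
    ∃ B', TableRep Γ N S ((contractAllCmd K).run N η A) B' ∧ numBlocks N B' ≤ 1 := by
  have hcard := card_lt_of_forall_lt hS hN
  obtain ⟨B', hB', hle⟩ := Cmd.run_loop_measure (R := TableRep Γ N S) (numBlocks N) (x := .aux 5)
    (c := .loops (slots K) (.ifnz (moduleE K) (contractCmd K))) (η := η) 1 (fun i _ A B h => by
      obtain ⟨B', hB', h'⟩ := Cmd.run_loops_measure (R := TableRep Γ N S) (numBlocks N)
        (xs := slots K) (c := .ifnz (moduleE K) (contractCmd K))
        (η := Function.update η (.aux 5) i)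
        (fun ζ B => ¬ IsModuleTuple Γ B fun i : Fin (K + 2) => ζ (.slot i)) (fun ζ hζ A B h => by
          have hζN : ∀ i : Fin (K + 2), ζ (.slot i) < N := fun i => hζ.2 _ (by
            simp only [slots, List.mem_ofFn, Name.slot.injEq]
            exact ⟨i, rfl⟩)
          by_cases hw : IsModuleTuple Γ B fun i : Fin (K + 2) => ζ (.slot i)
          · refine ⟨_, ?_, Or.inl (numBlocks_contract_lt hw (hζN 1))⟩
            rw [Cmd.run_ifnz_of_holds ((h.holds_moduleE hS hζN).2 hw)]
            exact h.run_contractCmd hcard hζN hw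
          · refine ⟨B, ?_, Or.inr ⟨rfl, hw⟩⟩
            rw [Cmd.run_ifnz_of_not_holds fun hh => hw ((h.holds_moduleE hS hζN).1 hh)]
            exact h) h
      refine ⟨B', hB', h'.imp id fun h' => ⟨h'.1, ?_⟩⟩
      -- If no tuple is a module, there is at most one representative.
      by_contra hlt
      obtain ⟨w, hwN, hw⟩ := exists_isModuleTuple hΓ hS h.partition (not_le.1 hlt)
      let ζ : Env := fun y => match y with
        | .slot j => if hj : j < K + 2 then w ⟨j, hj⟩ else Function.update η (.aux 5) i (.slot j)
        | y => Function.update η (.aux 5) i y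
      have hζw : (fun j : Fin (K + 2) => ζ (.slot j)) = w := by
        funext j
        simp [ζ]
      refine h'.2 ζ ⟨fun y hy => ?_, fun y hy => ?_⟩ (hζw.symm ▸ hw)
      · cases y with
        | aux j => rfl
        | mult j => rfl
        | slot j =>
          simp only [slots, List.mem_ofFn, Name.slot.injEq, not_exists] at hy
          exact dif_neg fun hj => hy ⟨j, hj⟩ rfl
      · simp only [slots, List.mem_ofFn] at hy
        obtain ⟨j, rfl⟩ := hy
        exact (congrFun hζw j).trans_lt (hwN j)) h
  refine ⟨B', hB', ?_⟩
  have hle' : numBlocks N B < N := by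
    refine (Finset.card_lt_card (Finset.ssubset_iff_of_subset (Finset.filter_subset _ _) |>.2
      ⟨N - 1, by simpa using hN, fun hmem => ?_⟩)).trans_eq (Finset.card_range N)
    have := hS _ (h.partition.mem_of_nonempty (Finset.mem_filter.1 hmem).2)
    omega
  omega

open Classical in
theorem run_initCmd (hA : AdjArray Γ N (A 0)) (h2 : ∀ u < N, A 2 u ≠ 0 ↔ u ∈ S) (η : Env) :
    TableRep Γ N S (initCmd.run N η A) fun u => if u ∈ S then {u} else ∅ := by
  have h₁ := Cmd.filled_loops_put (N := N) (a := 3) (xs := [.aux 4]) (i := .var (.aux 4))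
    (e := .get 2 (.var (.aux 4))) (η := η) (k := fun ζ => ζ (.aux 4))
    (v := fun ζ => A 2 (ζ (.aux 4))) (A₀ := A)
    (fun ζ hζ A' hA' => ⟨rfl, by rw [Exp.eval, hA' 2 (by simp)]; rfl⟩) (fun b _ => rfl)
  set A₁ := (Cmd.loops [.aux 4] (.put 3 (.var (.aux 4)) (.get 2 (.var (.aux 4))))).run N η A
  have h₂ := Cmd.filled_loops_put (N := N) (a := 4) (xs := .aux 4 :: triple)
    (i := keyE (.var (.aux 4)) tripleE)
    (e := .ind (.and (.lt (tripleE 0) (.const 2)) (.and (.eq (tripleE 1) (.const 0))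
        (.eq (tripleE 2) (.const 0))))) (η := η)
    (k := fun ζ => key N (ζ (.aux 4)) fun j : Fin 3 => ζ (.aux (j + 1)))
    (v := fun ζ => if ζ (.aux 1) < 2 ∧ ζ (.aux 2) = 0 ∧ ζ (.aux 3) = 0 then 1 else 0)
    (A₀ := A₁) (fun ζ hζ A' hA' => by
      refine ⟨?_, ?_⟩
      · rw [eval_keyE (Exp.fresh_var (by simp)) fresh_tripleE]
        rfl
      · simp [tripleE, Exp.eval]) (fun b _ => rfl)
  have hrun : initCmd.run N η A = (Cmd.loops (.aux 4 :: triple) (.put 4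
    (keyE (.var (.aux 4)) tripleE) (.ind (.and (.lt (tripleE 0) (.const 2))
      (.and (.eq (tripleE 1) (.const 0)) (.eq (tripleE 2) (.const 0))))))).run N η A₁ := rfl
  rw [← hrun] at h₂
  have hbox : ∀ ζ ∈ Box N (.aux 4 :: triple) η, ∀ j : Fin 3, ζ (.aux (j + 1)) < N := by
    intro ζ hζ j
    refine hζ.2 _ ?_
    fin_cases j <;> simp [triple]
  refine ⟨blockPartition_singletons Γ S, ?_, fun u hu => ?_, fun u hu hne c hc => ?_⟩
  · rw [h₂.1 0 (by simp), h₁.1 0 (by simp)]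
    exact hA
  · have hζ : Function.update η (.aux 4) u ∈ Box N [.aux 4] η :=
      mem_box_cons.2 ⟨u, hu, by rw [box_nil]; rfl⟩
    have := h₁.apply (fun ζ _ ξ _ hk => by rw [hk]) hζ
    simp only [Function.update_self] at this
    rw [h₂.1 3 (by simp), this, h2 u hu]
    split_ifs with huS <;> simp [huS]
  · have huS : u ∈ S := by
      by_contra h
      simp [h] at hne
    obtain ⟨ζ, hζ, rfl⟩ := exists_mem_box_triple (Function.update η (.aux 4) u) hc
    have hζu : ζ (.aux 4) = u := by
      rw [hζ.1 _ (by simp [triple])]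
      simp
    have hζ' : ζ ∈ Box N (.aux 4 :: triple) η := mem_box_cons.2 ⟨u, hu, hζ⟩
    have := h₂.apply (fun ζ hζ ξ hξ hk => by
      have hk := (key_inj (hbox ζ hζ) (hbox ξ hξ) hk).2
      have h0 := congrFun hk 0
      have h1 := congrFun hk 1
      have h2 := congrFun hk 2
      simp only [Fin.val_zero, Fin.val_one, Fin.val_two, Nat.zero_add, Nat.reduceAdd] at h0 h1 h2
      rw [h0, h1, h2]) hζ'
    rw [hζu] at this
    rw [this, if_pos huS, SimpleGraph.prof_singleton]
    simp only [Fin.val_zero, Fin.val_one, Fin.val_two, Nat.zero_add, Nat.reduceAdd]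
    split_ifs with hp
    · simp [hp.2, Nat.le_of_lt_succ hp.1]
    · simp only [ne_eq, not_true_eq_false, false_iff]
      exact fun h => hp ⟨Nat.lt_succ_of_le h.1, h.2⟩

theorem preserves_clearCmd {a : ℕ} (ha : a ≠ 3) (l : List (Fin (K + 2))) :
    (clearCmd K l).Preserves a := by
  induction l with
  | nil => trivial
  | cons i l ih => exact ⟨ha, ih⟩

theorem preserves_packNumCmd {a : ℕ} (h3 : a ≠ 3) (h4 : a ≠ 4) (h5 : a ≠ 5) (h6 : a ≠ 6) :
    (packNumCmd K).Preserves a := by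
  simp [packNumCmd, initCmd, contractAllCmd, contractCmd, Cmd.Preserves, h3, h4, h5, h6,
    preserves_clearCmd h3, Cmd.preserves_loops]

/-- The packing number is computed correctly. -/
theorem run_packNumCmd (hΓ : HasSmallModules Γ N K) (hN : 0 < N) (hA : AdjArray Γ N (A 0))
    (hS : ∀ u ∈ S, u + 1 < N) (h2 : ∀ u < N, A 2 u ≠ 0 ↔ u ∈ S) (η : Env) :
    (packNumCmd K).run N η A 6 0 = Γ.packNum S := by
  classical
  have hcard := card_lt_of_forall_lt hS hN
  obtain ⟨B, hB, h1⟩ := (run_initCmd hA h2 η).run_contractAllCmd hΓ hS hN η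
  set A' := (contractAllCmd K).run N η (initCmd.run N η A)
  have hfresh : ∀ j : Fin 3, (![.const 0, .const 0, .var (.aux 3)] j : Exp).Fresh := by
    intro j
    fin_cases j
    exacts [Exp.fresh_const 0, Exp.fresh_const 0, Exp.fresh_var (by simp)]
  have hiff : ∀ m < N, (Exp.and (.lt (.const 0) (.var (.aux 3)))
      (.ex (.aux 4) (profE (.aux 4) ![.const 0, .const 0, .var (.aux 3)]))).Holds N A'
        (Function.update η (.aux 3) m) ↔ m ∈ Finset.Icc 1 (Γ.packNum S) := by
    intro m hm
    rw [Exp.holds_and, Exp.holds_ex, Exp.holds_lt, Finset.mem_Icc]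
    have h0 : (Exp.const 0).eval N A' (Function.update η (.aux 3) m) <
        (Exp.var (.aux 3)).eval N A' (Function.update η (.aux 3) m) ↔ 1 ≤ m := by
      simp [Exp.eval, Nat.one_le_iff_ne_zero, Nat.pos_iff_ne_zero]
    rw [h0]
    refine and_congr_right fun hm1 => ?_
    rw [← exists_prof_triangles_iff hS hB.partition h1 (by omega)]
    refine exists_congr fun u => and_congr_right fun hu => ?_
    rw [hB.holds_profE hcard (by simp) (by simpa using hu) hfresh]
    have hc : (fun j => (![.const 0, .const 0, .var (.aux 3)] j : Exp).eval N A'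
        (Function.update (Function.update η (.aux 3) m) (.aux 4) u)) = ![0, 0, m] := by
      funext j
      fin_cases j <;> simp [Exp.eval]
    rw [hc, Function.update_self]
  have hlt : Γ.packNum S < N := (Γ.packNum_le_card S).trans_lt hcard
  have hval : (packNumCmd K).run N η A 6 0 = ∑ m ∈ Finset.range N,
      (Exp.ind (.and (.lt (.const 0) (.var (.aux 3)))
        (.ex (.aux 4) (profE (.aux 4) ![.const 0, .const 0, .var (.aux 3)])))).eval N A'
          (Function.update η (.aux 3) m) := by
    simp only [packNumCmd, Cmd.run, Exp.eval, Function.update_self]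
    rfl
  rw [hval, Finset.sum_congr rfl fun m hm =>
    Exp.eval_ind.trans (if_congr (hiff m (Finset.mem_range.1 hm)) rfl rfl), Finset.sum_boole]
  have : (Finset.range N).filter (· ∈ Finset.Icc 1 (Γ.packNum S)) =
      Finset.Icc 1 (Γ.packNum S) := by
    ext m
    simp only [Finset.mem_filter, Finset.mem_range, Finset.mem_Icc]
    omega
  rw [this]
  simp

end Commands

/-! ### The extraction of a maximum packing -/

section Main

variable (K : ℕ)

/-- The formula for the variables `aux 6`, `aux 7`, `aux 8` being a triangle of remaining
vertices. -/
def triangleE : Exp :=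
  .and (.and (.get 8 (.var (.aux 6))) (.and (.get 8 (.var (.aux 7))) (.get 8 (.var (.aux 8)))))
    (.and (adjE (.aux 6) (.aux 7)) (.and (adjE (.aux 6) (.aux 8)) (adjE (.aux 7) (.aux 8))))

/-- Stores the set of remaining vertices without `aux 6`, `aux 7`, `aux 8` in array `2`. -/
def restCmd : Cmd :=
  .loops [.aux 4] (.put 2 (.var (.aux 4)) (.and (.get 8 (.var (.aux 4)))
    (.and (.not (.eq (.var (.aux 4)) (.var (.aux 6))))
      (.and (.not (.eq (.var (.aux 4)) (.var (.aux 7))))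
        (.not (.eq (.var (.aux 4)) (.var (.aux 8))))))))

/-- Three times the number of triangles in the output. -/
def outE : Exp := .add (.add (.get 7 (.const 0)) (.get 7 (.const 0))) (.get 7 (.const 0))

/-- Moves the vertices `aux 6`, `aux 7`, `aux 8` to the output. -/
def commitCmd : Cmd :=
  .seq (.put 1 outE (.var (.aux 6))) (.seq (.put 1 (.add outE (.const 1)) (.var (.aux 7)))
    (.seq (.put 1 (.add outE (.const 2)) (.var (.aux 8)))
      (.seq (.put 8 (.var (.aux 6)) (.const 0)) (.seq (.put 8 (.var (.aux 7)) (.const 0))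
        (.seq (.put 8 (.var (.aux 8)) (.const 0))
          (.seq (.put 7 (.const 0) (.add (.get 7 (.const 0)) (.const 1)))
            (.put 9 (.const 0) (.get 6 (.const 0)))))))))

/-- Moves the triangle `aux 6`, `aux 7`, `aux 8` to the output if the packing number drops by one
only. -/
noncomputable def tryCmd : Cmd :=
  .ifnz triangleE (.seq restCmd (.seq (packNumCmd K)
    (.ifnz (.eq (.add (.get 6 (.const 0)) (.const 1)) (.get 9 (.const 0))) commitCmd)))

/-- Marks all vertices in array `a`. -/
def allVerticesCmd (a : ℕ) : Cmd :=
  .loops [.aux 4] (.put a (.var (.aux 4)) (.lt (.var (.aux 4)) (.sub boundE (.const 1))))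

/-- The loop that extracts a maximum packing. -/
noncomputable def extractCmd : Cmd :=
  .loop (.aux 9) (.loops [.aux 6, .aux 7, .aux 8] (tryCmd K))

/-- Computes a maximum packing in array `1` and its size in entry `0` of array `7`. -/
noncomputable def packingCmd : Cmd :=
  .seq (allVerticesCmd 8) (.seq (allVerticesCmd 2) (.seq (packNumCmd K)
    (.seq (.put 9 (.const 0) (.get 6 (.const 0))) (extractCmd K))))

variable {K} {Γ : SimpleGraph ℕ} {N : ℕ} {S : Finset ℕ} {A : Store} {P : Finset (Finset ℕ)}

/-- The members of `P` are the first `P.card` triples in the array `M`. -/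
def OutputArray (P : Finset (Finset ℕ)) (M : ℕ → ℕ) : Prop :=
  P = (Finset.range P.card).image fun t => {M (3 * t), M (3 * t + 1), M (3 * t + 2)}

/-- The arrays hold a set `S` of remaining vertices and a packing `P` in the complement of `S` that
together with a maximum packing in `S` is a maximum packing. -/
structure PartialPacking (Γ : SimpleGraph ℕ) (N : ℕ) (A : Store)
    (a : Finset ℕ × Finset (Finset ℕ)) : Prop where
  adj : AdjArray Γ N (A 0)
  lt : ∀ u ∈ a.1, u + 1 < N
  remaining : ∀ u < N, A 8 u ≠ 0 ↔ u ∈ a.1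
  packNum_eq : A 9 0 = Γ.packNum a.1
  card_eq : A 7 0 = a.2.card
  output : OutputArray a.2 (A 1)
  packing : Γ.IsTrianglePacking a.2
  disjoint : ∀ T ∈ a.2, Disjoint T a.1
  subset : ∀ T ∈ a.2, T ⊆ Finset.range (N - 1)
  card_add : a.2.card + Γ.packNum a.1 = Γ.packNum (Finset.range (N - 1))

theorem PartialPacking.congr {A' : Store} (h : PartialPacking Γ N A (S, P)) (h0 : A' 0 = A 0)
    (h1 : A' 1 = A 1) (h7 : A' 7 = A 7) (h8 : A' 8 = A 8) (h9 : A' 9 = A 9) :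
    PartialPacking Γ N A' (S, P) :=
  ⟨h0 ▸ h.adj, h.lt, h8 ▸ h.remaining, h9 ▸ h.packNum_eq, h7 ▸ h.card_eq, h1 ▸ h.output,
    h.packing, h.disjoint, h.subset, h.card_add⟩

theorem PartialPacking.run_commitCmd (h : PartialPacking Γ N A (S, P)) {η : Env} {a b c : ℕ}
    (ha : η (.aux 6) = a) (hb : η (.aux 7) = b) (hc : η (.aux 8) = c)
    (hT : Γ.IsNClique 3 {a, b, c}) (hTS : {a, b, c} ⊆ S)
    (h6 : A 6 0 = Γ.packNum (S \ {a, b, c})) (hdrop : Γ.packNum (S \ {a, b, c}) + 1 = Γ.packNum S) :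
    PartialPacking Γ N (commitCmd.run N η A) (S \ {a, b, c}, insert {a, b, c} P) := by
  obtain ⟨hP, hnot⟩ := h.packing.insert hT fun T hT' =>
    Finset.disjoint_of_subset_right hTS (h.disjoint T hT')
  have hcard : (insert {a, b, c} P).card = P.card + 1 := Finset.card_insert_of_notMem hnot
  have h7 : A 7 0 = P.card := h.card_eq
  have hout : P.card + P.card + P.card = 3 * P.card := by omega
  refine ⟨?_, fun u hu => h.lt u (Finset.sdiff_subset hu), fun u hu => ?_, ?_, ?_, ?_, hP,
    fun T hT' => ?_, fun T hT' => ?_, ?_⟩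
  · simpa [commitCmd, Cmd.run] using h.adj
  · have h8 := h.remaining u hu
    simp only at h8
    rw [Finset.mem_sdiff, ← h8]
    simp only [commitCmd, Cmd.run, Exp.eval, ha, hb, hc]
    simp only [ne_eq, Nat.reduceEqDiff, not_false_eq_true, Function.update_of_ne,
      Function.update_self, Finset.mem_insert, Finset.mem_singleton, OfNat.ofNat_ne_one,
      Function.update_apply]
    split_ifs <;> simp_all
  · simpa [commitCmd, Cmd.run, Exp.eval] using h6
  · simp [commitCmd, Cmd.run, Exp.eval, h7, hcard]
  · unfold OutputArray
    rw [hcard, Finset.range_add_one, Finset.image_insert]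
    have hM : commitCmd.run N η A 1 = Function.update (Function.update (Function.update (A 1)
        (3 * P.card) a) (3 * P.card + 1) b) (3 * P.card + 2) c := by
      simp [commitCmd, Cmd.run, Exp.eval, outE, h7, ha, hb, hc, hout]
    rw [hM]
    simp only [Function.update_self, Function.update_of_ne, ne_eq, Nat.add_right_cancel_iff,
      Nat.left_eq_add, OfNat.ofNat_ne_zero, one_ne_zero, not_false_eq_true]
    congr 1
    · have hP' : P = _ := h.output
      conv_lhs => rw [hP']
      refine Finset.image_congr fun t ht => ?_
      have ht : t < P.card := by simpa using ht
      have hne : ∀ i j, i < 3 → 3 * t + i ≠ 3 * P.card + j := by omega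
      have h0 : ∀ i, i < 3 → Function.update (Function.update (Function.update (A 1)
          (3 * P.card) a) (3 * P.card + 1) b) (3 * P.card + 2) c (3 * t + i) =
            A 1 (3 * t + i) := by
        intro i hi
        rw [Function.update_of_ne (hne i 2 hi), Function.update_of_ne (hne i 1 hi),
          Function.update_of_ne (by simpa using hne i 0 hi)]
      have h00 := h0 0 (by omega)
      simp only [Nat.add_zero] at h00
      rw [h00, h0 1 (by omega), h0 2 (by omega)]
  · rcases Finset.mem_insert.1 hT' with rfl | hT'
    · exact Finset.disjoint_sdiff
    · exact (h.disjoint T hT').mono_right Finset.sdiff_subset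
  · rcases Finset.mem_insert.1 hT' with rfl | hT'
    · intro u hu
      have := h.lt u (hTS hu)
      rw [Finset.mem_range]
      omega
    · exact h.subset T hT'
  · have := h.card_add
    simp only at this ⊢
    omega

theorem run_restCmd {η : Env} (h8 : ∀ u < N, A 8 u ≠ 0 ↔ u ∈ S) :
    (∀ b, b ≠ 2 → restCmd.run N η A b = A b) ∧ ∀ u < N, restCmd.run N η A 2 u ≠ 0 ↔
      u ∈ S \ {η (.aux 6), η (.aux 7), η (.aux 8)} := by
  have h := Cmd.filled_loops_put (N := N) (a := 2) (xs := [.aux 4]) (i := .var (.aux 4))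
    (e := .and (.get 8 (.var (.aux 4)))
    (.and (.not (.eq (.var (.aux 4)) (.var (.aux 6))))
      (.and (.not (.eq (.var (.aux 4)) (.var (.aux 7))))
        (.not (.eq (.var (.aux 4)) (.var (.aux 8))))))) (η := η) (k := fun ζ => ζ (.aux 4))
    (v := fun ζ => (Exp.and (.get 8 (.var (.aux 4)))
      (.and (.not (.eq (.var (.aux 4)) (.var (.aux 6))))
        (.and (.not (.eq (.var (.aux 4)) (.var (.aux 7))))
          (.not (.eq (.var (.aux 4)) (.var (.aux 8))))))).eval N A ζ) (A₀ := A)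
    (fun ζ hζ A' hA' => ⟨rfl, by
      simp only [Exp.and, Exp.or, Exp.not, Exp.eq, Exp.lt, Exp.eval, hA' 8 (by simp)]⟩)
    (fun b _ => rfl)
  refine ⟨h.1, fun u hu => ?_⟩
  have hζ : Function.update η (.aux 4) u ∈ Box N [.aux 4] η :=
    mem_box_cons.2 ⟨u, hu, by rw [box_nil]; rfl⟩
  have hinj : ∀ ζ ∈ Box N [.aux 4] η, ∀ ξ ∈ Box N [.aux 4] η, ζ (.aux 4) = ξ (.aux 4) →
      ζ = ξ := by
    intro ζ hζ ξ hξ hk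
    funext y
    by_cases hy : y = .aux 4
    · rw [hy, hk]
    · rw [hζ.1 y (by simpa using hy), hξ.1 y (by simpa using hy)]
  have h' := h.apply (fun ζ hζ ξ hξ hk => by rw [hinj ζ hζ ξ hξ hk]) hζ
  simp only [Function.update_self] at h'
  rw [restCmd, h', ← Exp.Holds]
  simp only [Exp.holds_and, Exp.holds_get, Exp.holds_not, Exp.holds_eq, Exp.eval,
    Function.update_self, ne_eq, Name.aux.injEq, Nat.reduceEqDiff, not_false_eq_true,
    Function.update_of_ne, Finset.mem_sdiff, Finset.mem_insert, Finset.mem_singleton, not_or]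
  rw [← h8 u hu]

theorem run_allVerticesCmd (a : ℕ) (η : Env) (A : Store) :
    (∀ b, b ≠ a → (allVerticesCmd a).run N η A b = A b) ∧ ∀ u < N,
      (allVerticesCmd a).run N η A a u ≠ 0 ↔ u ∈ Finset.range (N - 1) := by
  have h := Cmd.filled_loops_put (N := N) (a := a) (xs := [.aux 4]) (i := .var (.aux 4))
    (e := .lt (.var (.aux 4)) (.sub boundE (.const 1))) (η := η) (k := fun ζ => ζ (.aux 4))
    (v := fun ζ => N - 1 - ζ (.aux 4)) (A₀ := A)
    (fun ζ hζ A' hA' => ⟨rfl, by simp [Exp.lt, Exp.eval]⟩) (fun b _ => rfl)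
  refine ⟨h.1, fun u hu => ?_⟩
  have hζ : Function.update η (.aux 4) u ∈ Box N [.aux 4] η :=
    mem_box_cons.2 ⟨u, hu, by rw [box_nil]; rfl⟩
  have h' := h.apply (fun ζ _ ξ _ hk => by rw [hk]) hζ
  simp only [Function.update_self] at h'
  rw [allVerticesCmd, h', Finset.mem_range]
  omega

theorem PartialPacking.run_tryCmd (hΓ : HasSmallModules Γ N K) (hN : 0 < N)
    {a : Finset ℕ × Finset (Finset ℕ)} (h : PartialPacking Γ N A a) {ζ : Env}
    (h6 : ζ (.aux 6) < N) (h7 : ζ (.aux 7) < N) (h8 : ζ (.aux 8) < N) :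
    ∃ a', PartialPacking Γ N ((tryCmd K).run N ζ A) a' ∧
      (Γ.packNum a'.1 < Γ.packNum a.1 ∨ a' = a ∧
        ¬ (Γ.IsNClique 3 {ζ (.aux 6), ζ (.aux 7), ζ (.aux 8)} ∧
          {ζ (.aux 6), ζ (.aux 7), ζ (.aux 8)} ⊆ a.1 ∧
          Γ.packNum (a.1 \ {ζ (.aux 6), ζ (.aux 7), ζ (.aux 8)}) + 1 = Γ.packNum a.1)) := by
  obtain ⟨S, P⟩ := a
  have htri : triangleE.Holds N A ζ ↔ Γ.IsNClique 3 {ζ (.aux 6), ζ (.aux 7), ζ (.aux 8)} ∧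
      {ζ (.aux 6), ζ (.aux 7), ζ (.aux 8)} ⊆ S := by
    simp only [triangleE, Exp.holds_and, Exp.holds_get, Exp.eval,
      holds_adjE h.adj (x := .aux 6) (y := .aux 7) (by simp) h6 h7,
      holds_adjE h.adj (x := .aux 6) (y := .aux 8) (by simp) h6 h8,
      holds_adjE h.adj (x := .aux 7) (y := .aux 8) (by simp) h7 h8,
      SimpleGraph.is3Clique_triple_iff, Finset.insert_subset_iff, Finset.singleton_subset_iff,
      h.remaining _ h6, h.remaining _ h7, h.remaining _ h8]
    tauto
  by_cases ht : triangleE.Holds N A ζ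
  · obtain ⟨hT, hTS⟩ := htri.1 ht
    set T : Finset ℕ := {ζ (.aux 6), ζ (.aux 7), ζ (.aux 8)} with hTdef
    obtain ⟨hr, hr2⟩ := run_restCmd (A := A) (N := N) (η := ζ) h.remaining
    set A₁ := restCmd.run N ζ A
    have hnum := run_packNumCmd (A := A₁) (S := S \ T) hΓ hN ((hr 0 (by simp)).symm ▸ h.adj)
      (fun u hu => h.lt u (Finset.sdiff_subset hu)) hr2 ζ
    have hpres : ∀ {b}, b ≠ 2 → b ≠ 3 → b ≠ 4 → b ≠ 5 → b ≠ 6 →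
        (packNumCmd K).run N ζ A₁ b = A b := fun h2 h3 h4 h5 h6 =>
      ((preserves_packNumCmd h3 h4 h5 h6).run_eq ζ A₁).trans (hr _ h2)
    have hrun : (tryCmd K).run N ζ A = (Cmd.ifnz (.eq (.add (.get 6 (.const 0)) (.const 1))
        (.get 9 (.const 0))) commitCmd).run N ζ ((packNumCmd K).run N ζ A₁) :=
      Cmd.run_ifnz_of_holds ht
    rw [hrun]
    set A₂ := (packNumCmd K).run N ζ A₁
    have h₂ : PartialPacking Γ N A₂ (S, P) := h.congr (hpres (by simp) (by simp) (by simp)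
      (by simp) (by simp)) (hpres (by simp) (by simp) (by simp) (by simp) (by simp))
      (hpres (by simp) (by simp) (by simp) (by simp) (by simp))
      (hpres (by simp) (by simp) (by simp) (by simp) (by simp))
      (hpres (by simp) (by simp) (by simp) (by simp) (by simp))
    have heq : (Exp.eq (.add (.get 6 (.const 0)) (.const 1)) (.get 9 (.const 0))).Holds N A₂ ζ ↔
        Γ.packNum (S \ T) + 1 = Γ.packNum S := by
      rw [Exp.holds_eq]
      simp only [Exp.eval, hnum, h₂.packNum_eq]
    by_cases hdrop : Γ.packNum (S \ T) + 1 = Γ.packNum S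
    · rw [Cmd.run_ifnz_of_holds (heq.2 hdrop)]
      exact ⟨_, h₂.run_commitCmd rfl rfl rfl hT hTS hnum hdrop,
        Or.inl (Nat.lt_of_succ_le hdrop.le)⟩
    · rw [Cmd.run_ifnz_of_not_holds fun hh => hdrop (heq.1 hh)]
      exact ⟨_, h₂, Or.inr ⟨rfl, fun hh => hdrop hh.2.2⟩⟩
  · rw [tryCmd, Cmd.run_ifnz_of_not_holds ht]
    exact ⟨_, h, Or.inr ⟨rfl, fun hh => ht (htri.2 ⟨hh.1, hh.2.1⟩)⟩⟩

theorem PartialPacking.run_extractCmd (hΓ : HasSmallModules Γ N K) (hN : 0 < N)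
    {a : Finset ℕ × Finset (Finset ℕ)} (h : PartialPacking Γ N A a) (η : Env) :
    ∃ a', PartialPacking Γ N ((extractCmd K).run N η A) a' ∧ Γ.packNum a'.1 = 0 := by
  obtain ⟨a', ha', hle⟩ := Cmd.run_loop_measure (R := PartialPacking Γ N) (fun a => Γ.packNum a.1)
    (x := .aux 9) (c := .loops [.aux 6, .aux 7, .aux 8] (tryCmd K)) (η := η) 0
    (fun i _ A a h => by
      obtain ⟨a', ha', h'⟩ := Cmd.run_loops_measure (R := PartialPacking Γ N)
        (fun a => Γ.packNum a.1) (xs := [.aux 6, .aux 7, .aux 8]) (c := tryCmd K)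
        (η := Function.update η (.aux 9) i)
        (fun ζ a => ¬ (Γ.IsNClique 3 {ζ (.aux 6), ζ (.aux 7), ζ (.aux 8)} ∧
          {ζ (.aux 6), ζ (.aux 7), ζ (.aux 8)} ⊆ a.1 ∧
          Γ.packNum (a.1 \ {ζ (.aux 6), ζ (.aux 7), ζ (.aux 8)}) + 1 = Γ.packNum a.1))
        (fun ζ hζ A a h => h.run_tryCmd hΓ hN (hζ.2 _ (by simp)) (hζ.2 _ (by simp))
          (hζ.2 _ (by simp))) h
      refine ⟨a', ha', h'.imp id fun h' => ⟨h'.1, ?_⟩⟩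
      by_contra hpos
      obtain ⟨T, hTS, hT, hdrop⟩ := Γ.exists_triangle_packNum (S := a.1) (by omega)
      obtain ⟨x, y, z, -, -, -, rfl⟩ := SimpleGraph.is3Clique_iff.1 hT
      have hlt : ∀ u ∈ ({x, y, z} : Finset ℕ), u < N := fun u hu =>
        Nat.lt_of_succ_lt (h.lt u (hTS hu))
      refine h'.2 (Function.update (Function.update (Function.update (Function.update η (.aux 9) i)
        (.aux 6) x) (.aux 7) y) (.aux 8) z) (mem_box_cons.2 ⟨x, hlt x (by simp), mem_box_cons.2
          ⟨y, hlt y (by simp), mem_box_cons.2 ⟨z, hlt z (by simp), by rw [box_nil]; rfl⟩⟩⟩) ?_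
      simpa using ⟨hT, hTS, hdrop⟩) h
  refine ⟨a', ha', ?_⟩
  have h₁ := Γ.packNum_le_card a.1
  have h₂ := card_lt_of_forall_lt h.lt hN
  omega

/-- The command computes a maximum packing. -/
theorem run_packingCmd (hΓ : HasSmallModules Γ N K) (hN : 0 < N) (hA : AdjArray Γ N (A 0))
    (h7 : A 7 0 = 0) (η : Env) : ∃ P : Finset (Finset ℕ), Γ.IsTrianglePacking P ∧
      (∀ T ∈ P, T ⊆ Finset.range (N - 1)) ∧ P.card = Γ.packNum (Finset.range (N - 1)) ∧
      (packingCmd K).run N η A 7 0 = P.card ∧ OutputArray P ((packingCmd K).run N η A 1) := by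
  obtain ⟨h₁, h₁'⟩ := run_allVerticesCmd (N := N) 8 η A
  set A₁ := (allVerticesCmd 8).run N η A
  obtain ⟨h₂, h₂'⟩ := run_allVerticesCmd (N := N) 2 η A₁
  set A₂ := (allVerticesCmd 2).run N η A₁
  have hlt : ∀ u ∈ Finset.range (N - 1), u + 1 < N := fun u hu => by
    rw [Finset.mem_range] at hu
    omega
  have h0 : A₂ 0 = A 0 := (h₂ 0 (by simp)).trans (h₁ 0 (by simp))
  have hnum := run_packNumCmd (A := A₂) hΓ hN (h0.symm ▸ hA) hlt h₂' η
  have hpres : ∀ {b}, b ≠ 3 → b ≠ 4 → b ≠ 5 → b ≠ 6 → (packNumCmd K).run N η A₂ b = A₂ b :=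
    fun h3 h4 h5 h6 => (preserves_packNumCmd h3 h4 h5 h6).run_eq η A₂
  set A₃ := (packNumCmd K).run N η A₂
  have hrun : (packingCmd K).run N η A = (extractCmd K).run N η
      ((Cmd.put 9 (.const 0) (.get 6 (.const 0))).run N η A₃) := rfl
  set A₄ := (Cmd.put 9 (.const 0) (.get 6 (.const 0))).run N η A₃ with hA₄
  have h₄ : ∀ {b}, b ≠ 9 → A₄ b = A₃ b := fun hb => Function.update_of_ne hb _ _
  have hA4 : ∀ {b}, b ≠ 2 → b ≠ 3 → b ≠ 4 → b ≠ 5 → b ≠ 6 → b ≠ 9 → A₄ b = A₁ b :=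
    fun h2 h3 h4 h5 h6 h9 => ((h₄ h9).trans (hpres h3 h4 h5 h6)).trans (h₂ _ h2)
  have hinit : PartialPacking Γ N A₄ (Finset.range (N - 1), ∅) := by
    refine ⟨?_, hlt, ?_, ?_, ?_, ?_, ⟨by simp, by simp⟩, by simp, by simp, by simp⟩
    · rw [hA4 (by simp) (by simp) (by simp) (by simp) (by simp) (by simp), h₁ 0 (by simp)]
      exact hA
    · rw [hA4 (by simp) (by simp) (by simp) (by simp) (by simp) (by simp)]
      exact h₁'
    · rw [← hnum]
      simp [hA₄, Cmd.run, Exp.eval]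
    · rw [hA4 (by simp) (by simp) (by simp) (by simp) (by simp) (by simp), h₁ 7 (by simp), h7]
      simp
    · simp [OutputArray]
  obtain ⟨⟨S, P⟩, h, hS⟩ := hinit.run_extractCmd hΓ hN η
  rw [← hrun] at h
  refine ⟨P, h.packing, h.subset, ?_, h.card_eq, h.output⟩
  have hadd : P.card + Γ.packNum S = _ := h.card_add
  have hS : Γ.packNum S = 0 := hS
  omega

end Main

/-! ### Graphs on `Fin n` -/

/-- A decomposition tree yields small modules. -/
theorem SimpleGraph.IsModular.hasSmallModules {n k : ℕ} {G : SimpleGraph (Fin n)}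
    (hG : G.IsModular k) : HasSmallModules (G.map Fin.valEmbedding) (n + 1) k := by
  obtain ⟨T, hT, hk⟩ := hG
  intro A hA h2
  have hAn : ∀ u ∈ A, u < n := fun u hu => by
    have := hA u hu
    omega
  obtain ⟨M, hMA, hM2, hMk, hM⟩ := T.exists_module hT.nodup_leaves hk (A := A.attachFin hAn)
    (fun v _ => hT.mem_leaves v) (by rwa [Finset.card_attachFin])
  refine ⟨M.map Fin.valEmbedding, fun u hu => ?_, by rwa [Finset.card_map],
    by rwa [Finset.card_map], fun u hu huM x hx y hy => ?_⟩
  · obtain ⟨v, hv, rfl⟩ := Finset.mem_map.1 hu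
    exact (Finset.mem_attachFin _).1 (hMA hv)
  · obtain ⟨x, hxM, rfl⟩ := Finset.mem_map.1 hx
    obtain ⟨y, hyM, rfl⟩ := Finset.mem_map.1 hy
    have := hM ⟨u, hAn u hu⟩ ((Finset.mem_attachFin _).2 hu)
      (fun h => huM (Finset.mem_map.2 ⟨_, h, rfl⟩)) x hxM y hyM
    rw [← hT.adj_iff, ← hT.adj_iff] at this
    have hu' : u = Fin.valEmbedding (⟨u, hAn u hu⟩ : Fin n) := rfl
    rw [hu', SimpleGraph.map_adj_apply, SimpleGraph.map_adj_apply]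
    exact this

theorem adjArray_graphInput {n : ℕ} (G : SimpleGraph (Fin n)) :
    AdjArray (G.map Fin.valEmbedding) (n + 1) ((graphInput G).arr 0) := by
  intro u _ v _
  have harr : ∀ m, (graphInput G).arr 0 m ≠ 0 ↔
      ∃ i j : Fin n, m = i.val * n + j.val ∧ G.Adj i j := by
    intro m
    simp [graphInput]
  rw [harr, SimpleGraph.map_adj, Nat.add_sub_cancel, Nat.mul_add_one, Nat.add_sub_cancel]
  constructor
  · rintro ⟨i, j, hij, rfl, rfl⟩
    exact ⟨j.2, i, j, rfl, hij⟩
  · rintro ⟨hv, i, j, hm, hij⟩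
    obtain ⟨h₁, h₂⟩ := mul_add_inj hv j.2 hm
    exact ⟨i, j, hij, h₁.symm, h₂.symm⟩

theorem SimpleGraph.IsTrianglePacking.map {n : ℕ} {G : SimpleGraph (Fin n)}
    {Q : Finset (Finset (Fin n))} (hQ : G.IsTrianglePacking Q) :
    (G.map Fin.valEmbedding).IsTrianglePacking (Q.image fun T => T.map Fin.valEmbedding) where
  isTriangle := by
    simp only [Finset.mem_image]
    rintro _ ⟨T, hT, rfl⟩
    exact (hQ.isTriangle T hT).map
  disjoint := by
    simp only [Finset.mem_image]
    rintro _ ⟨S, hS, rfl⟩ _ ⟨T, hT, rfl⟩ hne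
    rw [Finset.disjoint_map]
    exact hQ.disjoint S hS T hT fun h => hne (by rw [h])

theorem SimpleGraph.IsTrianglePacking.exists_map_eq {n : ℕ} {G : SimpleGraph (Fin n)}
    {P : Finset (Finset ℕ)} (hP : (G.map Fin.valEmbedding).IsTrianglePacking P)
    (hn : ∀ T ∈ P, T ⊆ Finset.range n) : ∃ Q : Finset (Finset (Fin n)),
      G.IsTrianglePacking Q ∧ Q.image (fun T => T.map Fin.valEmbedding) = P := by
  have hinj : Function.Injective fun T : Finset (Fin n) => T.map Fin.valEmbedding :=
    Finset.map_injective _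
  refine ⟨P.preimage (fun T => T.map Fin.valEmbedding) hinj.injOn, ⟨fun T hT => ?_,
    fun S hS T hT hne => ?_⟩, ?_⟩
  · have hT' := hP.isTriangle _ (Finset.mem_preimage.1 hT)
    refine ⟨fun x hx y hy hxy => ?_, ?_⟩
    · have := hT'.isClique (Finset.mem_map_of_mem _ hx) (Finset.mem_map_of_mem _ hy)
        (Fin.valEmbedding.injective.ne hxy)
      rwa [SimpleGraph.map_adj_apply] at this
    · rw [← hT'.card_eq, Finset.card_map]
  · have := hP.disjoint _ (Finset.mem_preimage.1 hS) _ (Finset.mem_preimage.1 hT)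
      (hinj.ne hne)
    rwa [Finset.disjoint_map] at this
  · refine (Finset.image_preimage _ _ _).trans (Finset.filter_true_of_mem fun T hT => ?_)
    refine ⟨T.attachFin fun u hu => Finset.mem_range.1 (hn T hT hu), ?_⟩
    exact Finset.map_valEmbedding_attachFin _

theorem mainTheorem5 :
    ∀ k : ℕ, ∃ (A : RAM.Prog) (p : Polynomial ℕ),
      ∀ (n : ℕ) (G : SimpleGraph (Fin n)), G.IsModular k →
        ∃ (t : ℕ) (s : RAM.State) (P : Finset (Finset (Fin n))),
          RAM.Exec A (RAM.graphInput G) t s ∧ t ≤ p.eval n ∧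
            s.OutputsTriples P ∧ G.IsMaximumTrianglePacking P := by
  intro k
  obtain ⟨A, p, hA⟩ := (packingCmd k).exists_prog 7
  refine ⟨A, p, fun n G hG => ?_⟩
  obtain ⟨t, s, hexec, ht, harr, hreg⟩ := hA n G
  obtain ⟨P, hP, hPn, hcard, h7, hout⟩ := run_packingCmd hG.hasSmallModules (Nat.succ_pos n)
    (adjArray_graphInput G) (by simp [graphInput]) fun _ => 0
  rw [← harr] at h7 hout
  rw [Nat.add_sub_cancel] at hPn hcard
  obtain ⟨Q, hQ, rfl⟩ := hP.exists_map_eq hPn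
  have hinj : Function.Injective fun T : Finset (Fin n) => T.map Fin.valEmbedding :=
    Finset.map_injective _
  rw [Finset.card_image_of_injective _ hinj] at hcard h7
  refine ⟨t, s, Q, hexec, ht, ⟨by rw [hreg, h7], ?_⟩, hQ, fun Q' hQ' => ?_⟩
  · rw [OutputArray, Finset.card_image_of_injective _ hinj, ← h7, ← hreg] at hout
    simp only [Finset.map_eq_image, Fin.valEmbedding_apply] at hout
    exact hout
  · rw [hcard, ← Finset.card_image_of_injective Q' hinj]
    refine hQ'.map.card_le_packNum fun T hT => ?_
    obtain ⟨T, -, rfl⟩ := Finset.mem_image.1 hT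
    intro u hu
    obtain ⟨v, -, rfl⟩ := Finset.mem_map.1 hu
    exact Finset.mem_range.2 v.2
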